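/- Let $f:\mathbb R^n\to\mathbb R$, $g:\mathbb R^n\to\mathbb R^{m_e}$, $h:\mathbb R^n\to\mathbb R^{m_i}$ be twice continuously differentiable, $m_i\ge 1$, and consider $\min f(x)$ subject to $g(x)=0$, $h(x)+s=0$, $s\ge 0$, with Lagrangian $L(p,v)=f(x)+y^\top g(x)+z^\top(h(x)+s)-v^\top s$, $p=(x,s,y,z)$. All norms are Euclidean norms, resp. spectral norms of matrices. Let $(p^\star,v^\star)$, $p^\star=(x^\star,s^\star,y^\star,z^\star)$, satisfy the KKT conditions $$\nabla f(x^\star)+\nabla g(x^\star)^\top y^\star+\nabla h(x^\star)^\top z^\star=0,\quad z^\star=v^\star,\quad g(x^\star)=0,\quad h(x^\star)+s^\star=0,\quad 0\le s^\star\perp v^\star\ge 0 .$$ Let $\mathcal B=\{i: h_i(x^\star)=0\}$, $\ell=m_e+|\mathcal B|$, and let $A(x)$ be the active Jacobian, with rows $\nabla h_i(x)$ ($i\in\mathcal B$) and $\nabla g_j(x)$ ($1\le j\le m_e$). Assume that: $\nabla^2_{xx}L$ is Lipschitz continuous near $p^\star$; $A(x^\star)$ has full row rank; $z_i^\star>0$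 for $i\in\mathcal B$; and $d^\top\nabla^2_{xx}L(p^\star,v^\star)d>0$ for every nonzero $d$ with $A(x^\star)d=0$. For $(s,v)>0$ put $\Xi=s^\top v/m_i$, $G=\nabla g(x)$, $H=\nabla h(x)$, $W=\nabla^2_{xx}L(p,v)$, and $$K_\gamma=W+H^\top S^{-1}VH+\gamma G^\top G,\qquad S_\gamma=GK_\gamma^{-1}G^\top,$$ where $S=\operatorname{diag}(s)$, $V=\operatorname{diag}(v)$. Fix constants $C>0$, $\alpha\in(0,1)$ and $0<c_1\le c_2$. Call $(p,v,\gamma)$ *admissible* if $(s,v)>0$, $\|\nabla_pL(p,v)\|\le C\,\Xi$, $s_iv_i\ge\alpha\,\Xi$ for all $i$, and $c_1\Xi^{-1}\le\gamma\le c_2\Xi^{-1}$ (that is, $\gamma=\Theta(\Xi^{-1})$). A spectral decomposition of $K_\gamma$ is written $K_\gamma=[U_L\ U_S]\operatorname{diag}(\Sigma_L,\Sigma_S)[U_L\ U_S]^\top$ with $[U_L\ U_S]$ orthogonal, $\Sigma_L\in\mathbb R^{\ell\times\ell}$ and $\Sigma_S\in\mathbb R^{(n-\ell)\times(n-\ell)}$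 diagonal, and the diagonal entries of $\Sigma_L$ being the $\ell$ eigenvalues of $K_\gamma$ of largest magnitude. Then, in exact arithmetic, there is $r>0$ such that the following hold. 1. There is $b>0$ such that for every admissible $(p,v,\gamma)$ with $\|(p,v)-(p^\star,v^\star)\|<r$, the matrix $K_\gamma$ is symmetric positive definite, and for every spectral decomposition as above there are matrices $Y$ and $Z$ whose columns form orthonormal bases of the row space and of the null space of $A(x)$, respectively, with $\|U_L-Y\|\le b\,\Xi$ and $\|U_S-Z\|\le b\,\Xi$. 2. For every $b>0$ there is $M>0$ such that for every admissible $(p,v,\gamma)$ with $\|(p,v)-(p^\star,v^\star)\|<r$, every spectral decomposition as above, and every matrix $Y$ whose columns form an orthonormal basis of the row space of $A(x)$ with $\|U_L-Y\|\le b\,\Xi$, $$\bigl\|S_\gamma-GY\,\Sigma_L^{-1}\,Y^\top G^\top\bigr\|\le M\,\Xi^2 ,$$ that is, $S_\gamma=GY\Sigma_L^{-1}Y^\top G^\top+O(\Xi^2)$. -/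

import Mathlib

open scoped Matrix.Norms.L2Operator

noncomputable section

/-- Data of the nonlinear program `min f x` subject to `g x = 0`, `h x ≤ 0`, with `x` free. -/
structure NLP (n me mi : ℕ) where
  /-- objective -/
  f : EuclideanSpace ℝ (Fin n) → ℝ
  /-- equality constraints -/
  g : EuclideanSpace ℝ (Fin n) → EuclideanSpace ℝ (Fin me)
  /-- inequality constraints -/
  h : EuclideanSpace ℝ (Fin n) → EuclideanSpace ℝ (Fin mi)

/-- The space of tuples `p = (x, s, y, z)`, with the Euclidean norm. -/
abbrev PrimalDual (n me mi : ℕ) : Type :=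
  EuclideanSpace ℝ (Fin n ⊕ Fin mi ⊕ Fin me ⊕ Fin mi)

namespace PrimalDual

variable {n me mi : ℕ}

/-- Primal variable. -/
def x (p : PrimalDual n me mi) : EuclideanSpace ℝ (Fin n) :=
  WithLp.toLp 2 fun i => p (Sum.inl i)

/-- Slack variable. -/
def s (p : PrimalDual n me mi) : EuclideanSpace ℝ (Fin mi) :=
  WithLp.toLp 2 fun i => p (Sum.inr (Sum.inl i))

/-- Multiplier of the equality constraints. -/
def y (p : PrimalDual n me mi) : EuclideanSpace ℝ (Fin me) :=
  WithLp.toLp 2 fun i => p (Sum.inr (Sum.inr (Sum.inl i)))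

/-- Multiplier of the constraints `h x + s = 0`. -/
def z (p : PrimalDual n me mi) : EuclideanSpace ℝ (Fin mi) :=
  WithLp.toLp 2 fun i => p (Sum.inr (Sum.inr (Sum.inr i)))

end PrimalDual

/-- Jacobian matrix of `φ` at `x`: entry `(i, j)` is `∂ φ_i / ∂ x_j`. -/
def jacobian {n m : ℕ} (φ : EuclideanSpace ℝ (Fin n) → EuclideanSpace ℝ (Fin m))
    (x : EuclideanSpace ℝ (Fin n)) : Matrix (Fin m) (Fin n) ℝ :=
  Matrix.of fun i j => (fderiv ℝ φ x (EuclideanSpace.single j 1)) i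

/-- Hessian matrix of `φ` at `x`: entry `(i, j)` is `∂_j ∂_i φ`. -/
def hessianMatrix {n : ℕ} (φ : EuclideanSpace ℝ (Fin n) → ℝ)
    (x : EuclideanSpace ℝ (Fin n)) : Matrix (Fin n) (Fin n) ℝ :=
  Matrix.of fun i j =>
    fderiv ℝ (fun x' => fderiv ℝ φ x' (EuclideanSpace.single i 1)) x (EuclideanSpace.single j 1)

/-- Duality measure `Ξ(s, v) = sᵀ v / m_i`. -/
def dualityMeasure {mi : ℕ} (s v : EuclideanSpace ℝ (Fin mi)) : ℝ :=
  (∑ i, s i * v i) / mi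

namespace NLP

variable {n me mi : ℕ} (P : NLP n me mi)

/-- Lagrangian `f(x) + yᵀ g(x) + zᵀ (h(x) + s) - vᵀ s` in terms of all its variables. -/
def lagrangianAt (x : EuclideanSpace ℝ (Fin n)) (s : EuclideanSpace ℝ (Fin mi))
    (y : EuclideanSpace ℝ (Fin me)) (z v : EuclideanSpace ℝ (Fin mi)) : ℝ :=
  P.f x + inner ℝ y (P.g x) + inner ℝ z (P.h x + s) - inner ℝ v s

/-- Lagrangian as a function of `p = (x, s, y, z)` and `v`. -/
def lagrangian (p : PrimalDual n me mi) (v : EuclideanSpace ℝ (Fin mi)) : ℝ :=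
  P.lagrangianAt p.x p.s p.y p.z v

/-- The Hessian `W = ∇²_{xx} L(p, v)` of the Lagrangian. -/
def W (p : PrimalDual n me mi) (v : EuclideanSpace ℝ (Fin mi)) : Matrix (Fin n) (Fin n) ℝ :=
  hessianMatrix (fun x => P.lagrangianAt x p.s p.y p.z v) p.x

/-- The Jacobian `G = ∇g(x)`. -/
def G (p : PrimalDual n me mi) : Matrix (Fin me) (Fin n) ℝ := jacobian P.g p.x

/-- The Jacobian `H = ∇h(x)`. -/
def H (p : PrimalDual n me mi) : Matrix (Fin mi) (Fin n) ℝ := jacobian P.h p.x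

open Classical in
/-- The active set `{i | h_i(x) = 0}`. -/
def activeSet (x : EuclideanSpace ℝ (Fin n)) : Finset (Fin mi) :=
  Finset.univ.filter fun i => P.h x i = 0

/-- The number `ℓ = m_e + m_a` of equality constraints and of inequalities active at `x`. -/
def numActive (x : EuclideanSpace ℝ (Fin n)) : ℕ := me + (P.activeSet x).card

/-- The active Jacobian, evaluated at `p`, for the constraints indexed by `B`:
the rows of `H` in `B` followed by the rows of `G`. -/
def activeJacobian (B : Finset (Fin mi)) (p : PrimalDual n me mi) :
    Matrix ({i // i ∈ B} ⊕ Fin me) (Fin n) ℝ :=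
  Matrix.fromRows ((P.H p).submatrix (fun i : {i // i ∈ B} => (i : Fin mi)) id) (P.G p)

/-- The KKT conditions at `(p, v)`. -/
structure IsKKT (p : PrimalDual n me mi) (v : EuclideanSpace ℝ (Fin mi)) : Prop where
  stationary : WithLp.ofLp (gradient P.f p.x) + (P.G p).transpose.mulVec (WithLp.ofLp p.y)
    + (P.H p).transpose.mulVec (WithLp.ofLp p.z) = 0
  dual : p.z - v = 0
  eq_feasible : P.g p.x = 0
  ineq_feasible : P.h p.x + p.s = 0
  slack_nonneg : ∀ i, 0 ≤ p.s i
  mult_nonneg : ∀ i, 0 ≤ v i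
  complementary : ∀ i, p.s i * v i = 0

/-- Regularity of a primal-dual solution `(p, v)`: locally Lipschitz Hessian of the Lagrangian,
linear independence constraint qualification, strict complementarity and second-order
sufficiency. -/
structure IsRegular (p : PrimalDual n me mi) (v : EuclideanSpace ℝ (Fin mi)) : Prop where
  lipschitz : ∃ k : NNReal, ∃ t ∈ nhds p, LipschitzOnWith k (fun q => P.W q v) t
  licq : LinearIndependent ℝ (P.activeJacobian (P.activeSet p.x) p).row
  strict_compl : ∀ i ∈ P.activeSet p.x, 0 < p.z i
  sosc : ∀ d : Fin n → ℝ, d ≠ 0 → (P.activeJacobian (P.activeSet p.x) p).mulVec d = 0 →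
    0 < dotProduct d ((P.W p v).mulVec d)

/-- The centrality conditions with constants `C` and `α`. -/
structure IsCentral (C α : ℝ) (p : PrimalDual n me mi) (v : EuclideanSpace ℝ (Fin mi)) :
    Prop where
  gradient_le : ‖gradient (fun q => P.lagrangian q v) p‖ ≤ C * dualityMeasure p.s v
  slack_pos : ∀ i, 0 < p.s i
  mult_pos : ∀ i, 0 < v i
  balanced : ∀ i, α * dualityMeasure p.s v ≤ p.s i * v i

/-- The matrix `K_γ = W + Hᵀ D_s H + γ Gᵀ G` with `D_s = S⁻¹ V`. -/
def Kγ (γ : ℝ) (p : PrimalDual n me mi) (v : EuclideanSpace ℝ (Fin mi)) :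
    Matrix (Fin n) (Fin n) ℝ :=
  P.W p v + (P.H p).transpose * Matrix.diagonal (fun i => v i / p.s i) * P.H p
    + γ • ((P.G p).transpose * P.G p)

/-- The Schur complement `S_γ = G K_γ⁻¹ Gᵀ`. -/
def Sγ (γ : ℝ) (p : PrimalDual n me mi) (v : EuclideanSpace ℝ (Fin mi)) :
    Matrix (Fin me) (Fin me) ℝ :=
  P.G p * (P.Kγ γ p v)⁻¹ * (P.G p).transpose

end NLP

/-- Euclidean distance `δ(p, v) = ‖(p, v) - (p⋆, v⋆)‖`. -/
def kktDist {n me mi : ℕ} (p pstar : PrimalDual n me mi) (v vstar : EuclideanSpace ℝ (Fin mi)) :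
    ℝ :=
  Real.sqrt (‖p - pstar‖ ^ 2 + ‖v - vstar‖ ^ 2)

/-- `K = [U_L U_S] diag(Σ_L, Σ_S) [U_L U_S]ᵀ` with `[U_L U_S]` orthogonal, where `Σ_L` carries
the `l` eigenvalues of largest magnitude. -/
structure IsSpectralSplit {n l : ℕ} (K : Matrix (Fin n) (Fin n) ℝ)
    (UL : Matrix (Fin n) (Fin l) ℝ) (US : Matrix (Fin n) (Fin (n - l)) ℝ)
    (σL : Fin l → ℝ) (σS : Fin (n - l) → ℝ) : Prop where
  orthogonal_left : (Matrix.fromCols UL US).transpose * Matrix.fromCols UL US = 1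
  orthogonal_right : Matrix.fromCols UL US * (Matrix.fromCols UL US).transpose = 1
  decomposition : K = Matrix.fromCols UL US *
    Matrix.fromBlocks (Matrix.diagonal σL) 0 0 (Matrix.diagonal σS) *
      (Matrix.fromCols UL US).transpose
  ordered : ∀ i j, |σS j| ≤ |σL i|

/-- The columns of `M` form an orthonormal basis of the subspace `V`. -/
def IsOrthonormalBasisMatrix {n k : ℕ} (M : Matrix (Fin n) (Fin k) ℝ)
    (V : Submodule ℝ (Fin n → ℝ)) : Prop :=
  M.transpose * M = 1 ∧ Submodule.span ℝ (Set.range M.col) = V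

end

/-! With $A=A(x)$, write $K_\gamma=A^\top DA+E$: $D$ carries $v_i/s_i$ on the active inequalities
and $\gamma$ on the equalities, and $E$ collects $W$ and the inactive inequalities. Near the
solution $E$ is bounded, while $D^{-1}=O(\Xi)$. Hence $\ell$ eigenvalues are at least of order
$\Xi^{-1}$ and the others are at most $\|E\|$ (Courant–Fischer on the row space and on the null
space of $A$).

The eigenvector equations then locate the eigenspaces. With $Q$ the projection onto the row space,
$(1-Q)K=(1-Q)E$ gives $(1-Q)U_L=(1-Q)EU_L\Sigma_L^{-1}=O(\Xi)$. Cancelling $A^\top$ in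
$KU_S=U_S\Sigma_S$ gives $DAU_S=O(1)$, so $AU_S=O(\Xi)$. Projecting and re-orthonormalizing yields
$Y$ and $Z$ (`exists_bases_near`).

For the Schur complement, split $K^{-1}$ along $U_L$ and $U_S$. Replacing $U_L$ by $Y$ costs
$O(\Xi)\,\|\Sigma_L^{-1}\|=O(\Xi^2)$. The $U_S$ term contains $GU_S=O(\Xi)$ twice around the bounded
factor $\Sigma_S^{-1}$ (`norm_schur_sub_le`). That bound needs $K_\gamma$ uniformly positive
definite, which follows from Finsler's lemma once all weights exceed a fixed penalty.
`exists_uniform_bounds` supplies constants valid on a whole neighbourhood. -/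

namespace Matrix

/-! ### Spectral norm estimates and orthonormalization. -/

section NormBounds

variable {m n : Type*} [Fintype m] [Fintype n]

theorem norm_toLp_sq (x : n → ℝ) : ‖WithLp.toLp 2 x‖ ^ 2 = x ⬝ᵥ x := by
  simp [EuclideanSpace.real_norm_sq_eq, dotProduct, pow_two (x _)]

theorem l2_opNorm_transpose [DecidableEq m] [DecidableEq n] (M : Matrix m n ℝ) : ‖Mᵀ‖ = ‖M‖ := by
  rw [← conjTranspose_eq_transpose_of_trivial, l2_opNorm_conjTranspose]

theorem mulVec_dotProduct_mulVec (M : Matrix m n ℝ) (x y : n → ℝ) :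
    (M *ᵥ x) ⬝ᵥ (M *ᵥ y) = x ⬝ᵥ (Mᵀ * M) *ᵥ y := by
  rw [← mulVec_mulVec, dotProduct_mulVec x, vecMul_transpose]

theorem mulVec_dotProduct_self_le [DecidableEq n] (M : Matrix m n ℝ) (x : n → ℝ) :
    (M *ᵥ x) ⬝ᵥ (M *ᵥ x) ≤ ‖M‖ ^ 2 * (x ⬝ᵥ x) := by
  rw [← norm_toLp_sq, ← norm_toLp_sq, ← mul_pow]
  exact pow_le_pow_left₀ (norm_nonneg _) (M.l2_opNorm_mulVec (WithLp.toLp 2 x)) 2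

theorem abs_dotProduct_mulVec_le [DecidableEq n] (M : Matrix n n ℝ) (x : n → ℝ) :
    |x ⬝ᵥ M *ᵥ x| ≤ ‖M‖ * (x ⬝ᵥ x) := by
  rw [← norm_toLp_sq]
  have h1 := abs_real_inner_le_norm (WithLp.toLp 2 x) (WithLp.toLp 2 (M *ᵥ x))
  have h2 : inner ℝ (WithLp.toLp 2 x) (WithLp.toLp 2 (M *ᵥ x)) = x ⬝ᵥ M *ᵥ x := by
    simp [PiLp.inner_apply, dotProduct, mul_comm]
  rw [h2] at h1
  have h3 : ‖WithLp.toLp 2 (M *ᵥ x)‖ ≤ ‖M‖ * ‖WithLp.toLp 2 x‖ :=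
    M.l2_opNorm_mulVec (WithLp.toLp 2 x)
  nlinarith [norm_nonneg (WithLp.toLp 2 x)]

theorem l2_opNorm_le_of_mulVec_dotProduct_self_le [DecidableEq n] (M : Matrix m n ℝ) {c : ℝ}
    (hc : 0 ≤ c) (h : ∀ x, (M *ᵥ x) ⬝ᵥ (M *ᵥ x) ≤ c ^ 2 * (x ⬝ᵥ x)) : ‖M‖ ≤ c := by
  rw [l2_opNorm_def]
  refine ContinuousLinearMap.opNorm_le_bound _ hc fun x => ?_
  have h1 := h x.ofLp
  rw [← norm_toLp_sq, ← norm_toLp_sq, ← mul_pow] at h1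
  exact le_of_sq_le_sq h1 (by positivity)

theorem l2_opNorm_le_one_of_transpose_mul_self [DecidableEq n] {M : Matrix m n ℝ}
    (h : Mᵀ * M = 1) : ‖M‖ ≤ 1 := by
  refine l2_opNorm_le_of_mulVec_dotProduct_self_le M zero_le_one fun x => ?_
  rw [mulVec_dotProduct_mulVec, h]
  simp

theorem l2_opNorm_mul_le_of_le {l : Type*} [Fintype l] [DecidableEq l] [DecidableEq n]
    {M : Matrix m n ℝ} {N : Matrix n l ℝ} {a b : ℝ} (hM : ‖M‖ ≤ a) (hN : ‖N‖ ≤ b) :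
    ‖M * N‖ ≤ a * b :=
  (l2_opNorm_mul M N).trans
    (mul_le_mul hM hN (norm_nonneg _) ((norm_nonneg _).trans hM))

open scoped MatrixOrder in
/-- A matrix with nearly orthonormal columns is close to a matrix with orthonormal columns. -/
theorem exists_orthonormal_mul_right [DecidableEq n] (M : Matrix m n ℝ) {ε : ℝ}
    (hε : ε < 1) (hM : ‖Mᵀ * M - 1‖ ≤ ε) :
    ∃ R : Matrix n n ℝ, (M * R)ᵀ * (M * R) = 1 ∧ ‖M - M * R‖ ≤ ε := by
  have hT : (Mᵀ * M).PosSemidef := by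
    simpa using posSemidef_conjTranspose_mul_self M
  have hT0 : 0 ≤ Mᵀ * M := nonneg_iff_posSemidef.2 hT
  -- Polar decomposition: this $R=(M^\top M)^{1/2}$ is the inverse of the required factor. The Gram
  -- matrix is within distance $1$ of the identity, hence invertible.
  set R := CFC.sqrt (Mᵀ * M) with hR
  have hRR : R * R = Mᵀ * M := CFC.sqrt_mul_sqrt_self _ hT0
  have hRp : R.PosSemidef := nonneg_iff_posSemidef.1 (CFC.sqrt_nonneg _)
  have hRt : Rᵀ = R := by simpa using hRp.1.eq
  have hu : IsUnit (Mᵀ * M) := by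
    have h1 : ‖1 - Mᵀ * M‖ < 1 := by rw [norm_sub_rev]; linarith
    simpa using (Units.oneSub _ h1).isUnit
  have hdet : IsUnit R.det := by
    rw [isUnit_iff_isUnit_det, ← hRR, det_mul] at hu
    exact isUnit_of_mul_isUnit_left hu
  have horth : (M * R⁻¹)ᵀ * (M * R⁻¹) = 1 := by
    rw [transpose_mul, transpose_nonsing_inv, hRt, Matrix.mul_assoc, ← Matrix.mul_assoc Mᵀ, ← hRR,
      Matrix.mul_assoc R, mul_nonsing_inv _ hdet, Matrix.mul_one, nonsing_inv_mul _ hdet]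
  refine ⟨R⁻¹, horth, ?_⟩
  have hε0 : 0 ≤ ε := (norm_nonneg _).trans hM
  -- Since $R^2-1=(R+1)(R-1)$ and $R\ge 0$, we have $|(R+1)y|\ge|y|$, so $\|R-1\|\le\|R^2-1\|$.
  have hR1 : ‖R - 1‖ ≤ ε := by
    refine l2_opNorm_le_of_mulVec_dotProduct_self_le _ hε0 fun x => ?_
    set y := (R - 1) *ᵥ x with hy
    have h1 : (Mᵀ * M - 1) *ᵥ x = R *ᵥ y + y := by
      rw [← hRR, hy, mulVec_mulVec, ← add_mulVec]
      congr 1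
      noncomm_ring
    have h2 := mulVec_dotProduct_self_le (Mᵀ * M - 1) x
    have h3 : 0 ≤ y ⬝ᵥ R *ᵥ y := by simpa using hRp.dotProduct_mulVec_nonneg y
    have h4 : 0 ≤ (R *ᵥ y) ⬝ᵥ (R *ᵥ y) := by
      rw [← norm_toLp_sq]; positivity
    rw [h1] at h2
    simp only [add_dotProduct, dotProduct_add, dotProduct_comm (R *ᵥ y) y] at h2
    have h5 : ‖Mᵀ * M - 1‖ ^ 2 * (x ⬝ᵥ x) ≤ ε ^ 2 * (x ⬝ᵥ x) := by
      have : 0 ≤ x ⬝ᵥ x := by rw [← norm_toLp_sq]; positivity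
      gcongr
    linarith
  have h6 : M - M * R⁻¹ = (M * R⁻¹) * (R - 1) := by
    rw [Matrix.mul_sub, Matrix.mul_assoc, nonsing_inv_mul _ hdet, Matrix.mul_one, Matrix.mul_one]
  rw [h6]
  simpa using l2_opNorm_mul_le_of_le (l2_opNorm_le_one_of_transpose_mul_self horth) hR1

end NormBounds

end Matrix

/-! ### Spectral splittings and Courant–Fischer bounds. -/

namespace IsSpectralSplit

open Matrix

variable {n l : ℕ} {K : Matrix (Fin n) (Fin n) ℝ} {UL : Matrix (Fin n) (Fin l) ℝ}
  {US : Matrix (Fin n) (Fin (n - l)) ℝ} {σL : Fin l → ℝ} {σS : Fin (n - l) → ℝ}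

theorem gram_blocks (h : IsSpectralSplit K UL US σL σS) :
    ULᵀ * UL = 1 ∧ ULᵀ * US = 0 ∧ USᵀ * UL = 0 ∧ USᵀ * US = 1 := by
  have h1 := h.orthogonal_left
  rw [transpose_fromCols, fromRows_mul_fromCols, ← fromBlocks_one, fromBlocks_inj] at h1
  exact h1

theorem gram_left (h : IsSpectralSplit K UL US σL σS) : ULᵀ * UL = 1 := h.gram_blocks.1

theorem gram_right (h : IsSpectralSplit K UL US σL σS) : USᵀ * US = 1 := h.gram_blocks.2.2.2

theorem eq_add (h : IsSpectralSplit K UL US σL σS) :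
    K = UL * diagonal σL * ULᵀ + US * diagonal σS * USᵀ := by
  rw [h.decomposition, fromCols_mul_fromBlocks, transpose_fromCols, fromCols_mul_fromRows]
  simp

theorem mul_left (h : IsSpectralSplit K UL US σL σS) : K * UL = UL * diagonal σL := by
  rw [h.eq_add, Matrix.add_mul, Matrix.mul_assoc _ _ UL, h.gram_left, Matrix.mul_assoc _ _ UL,
    h.gram_blocks.2.2.1]
  simp

theorem mul_right (h : IsSpectralSplit K UL US σL σS) : K * US = US * diagonal σS := by
  rw [h.eq_add, Matrix.add_mul, Matrix.mul_assoc _ _ US, h.gram_blocks.2.1,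
    Matrix.mul_assoc (US * _) _ US, h.gram_right]
  simp

theorem eigenvalue_left_ge (h : IsSpectralSplit K UL US σL σS) {κ : ℝ}
    (hK : ∀ x, κ * (x ⬝ᵥ x) ≤ x ⬝ᵥ K *ᵥ x) (i : Fin l) : κ ≤ σL i := by
  have h1 := hK (UL *ᵥ Pi.single i 1)
  rw [mulVec_mulVec, h.mul_left, ← mulVec_mulVec, mulVec_dotProduct_mulVec,
    mulVec_dotProduct_mulVec, h.gram_left] at h1
  simpa using h1

theorem eigenvalue_right_ge (h : IsSpectralSplit K UL US σL σS) {κ : ℝ}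
    (hK : ∀ x, κ * (x ⬝ᵥ x) ≤ x ⬝ᵥ K *ᵥ x) (i : Fin (n - l)) : κ ≤ σS i := by
  have h1 := hK (US *ᵥ Pi.single i 1)
  rw [mulVec_mulVec, h.mul_right, ← mulVec_mulVec, mulVec_dotProduct_mulVec,
    mulVec_dotProduct_mulVec, h.gram_right] at h1
  simpa using h1

theorem dotProduct_mulVec_combination (h : IsSpectralSplit K UL US σL σS)
    (c : Fin l ⊕ Fin (n - l) → ℝ) :
    (fromCols UL US *ᵥ c) ⬝ᵥ K *ᵥ (fromCols UL US *ᵥ c)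
      = ∑ k, Sum.elim σL σS k * c k ^ 2 := by
  have h1 : K * fromCols UL US = fromCols UL US * diagonal (Sum.elim σL σS) := by
    conv_lhs => rw [h.decomposition]
    rw [Matrix.mul_assoc, h.orthogonal_left, Matrix.mul_one, fromBlocks_diagonal]
  rw [mulVec_mulVec, h1, ← mulVec_mulVec, mulVec_dotProduct_mulVec, h.orthogonal_left, one_mulVec]
  simp only [dotProduct, mulVec_diagonal]
  exact Finset.sum_congr rfl fun k _ => by ring

theorem dotProduct_self_combination (h : IsSpectralSplit K UL US σL σS)
    (c : Fin l ⊕ Fin (n - l) → ℝ) :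
    (fromCols UL US *ᵥ c) ⬝ᵥ (fromCols UL US *ᵥ c) = ∑ k, c k ^ 2 := by
  rw [mulVec_dotProduct_mulVec, h.orthogonal_left, one_mulVec]
  exact Finset.sum_congr rfl fun k _ => by ring

/-- Courant–Fischer upper bound: if the quadratic form of `K ≥ 0` is at most `w` on the kernel of
a matrix with `l` rows, then all but the `l` largest eigenvalues are at most `w`. -/
theorem eigenvalue_right_le (h : IsSpectralSplit K UL US σL σS)
    (hL : ∀ i, 0 ≤ σL i) (hS : ∀ i, 0 ≤ σS i) {ι : Type*} [Fintype ι]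
    (hι : Fintype.card ι = l) (A : Matrix ι (Fin n) ℝ) {w : ℝ}
    (hw : ∀ x, A *ᵥ x = 0 → x ⬝ᵥ K *ᵥ x ≤ w * (x ⬝ᵥ x)) (j : Fin (n - l)) : σS j ≤ w := by
  classical
  -- The $l$ dominant eigenvectors and the $j$-th remaining one span dimension $l+1$, so a nonzero
  -- combination is killed by the $l$ rows of `A`. All eigenvalues on this span are at least `σS j`.
  let F : (Fin l ⊕ Unit → ℝ) →ₗ[ℝ] (ι → ℝ) :=
    A.mulVecLin ∘ₗ (fromCols UL (US.submatrix id fun _ : Unit => j)).mulVecLin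
  obtain ⟨c, hc, hc0⟩ := (LinearMap.ker F).ne_bot_iff.1
    (LinearMap.ker_ne_bot_of_finrank_lt (by simp [hι]))
  let c' : Fin l ⊕ Fin (n - l) → ℝ := Sum.elim (c ∘ Sum.inl) (Pi.single j (c (Sum.inr ())))
  have hx : fromCols UL (US.submatrix id fun _ : Unit => j) *ᵥ c = fromCols UL US *ᵥ c' := by
    ext a
    simp [mulVec, dotProduct, c', Pi.single_apply]
  have hAx : A *ᵥ (fromCols UL US *ᵥ c') = 0 := by
    rw [← hx]; simpa [F] using hc
  have h1 := hw _ hAx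
  rw [h.dotProduct_mulVec_combination, h.dotProduct_self_combination] at h1
  have h2 : σS j * ∑ k, c' k ^ 2 ≤ ∑ k, Sum.elim σL σS k * c' k ^ 2 := by
    rw [Finset.mul_sum]
    refine Finset.sum_le_sum fun k _ => ?_
    rcases k with k | k
    · have h3 := h.ordered k j
      rw [abs_of_nonneg (hL k), abs_of_nonneg (hS j)] at h3
      exact mul_le_mul_of_nonneg_right h3 (sq_nonneg _)
    · rcases eq_or_ne k j with rfl | hk
      · rfl
      · simp [c', hk]
  have h3 : 0 < ∑ k, c' k ^ 2 := by
    obtain ⟨k, hk⟩ := Function.ne_iff.1 hc0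
    rcases k with k | k
    · exact Finset.sum_pos' (fun _ _ => sq_nonneg _) ⟨Sum.inl k, Finset.mem_univ _, by
        have : c (Sum.inl k) ≠ 0 := hk
        simp only [c', Sum.elim_inl, Function.comp]; positivity⟩
    · exact Finset.sum_pos' (fun _ _ => sq_nonneg _) ⟨Sum.inr j, Finset.mem_univ _, by
        have : c (Sum.inr ()) ≠ 0 := hk
        simp only [c', Sum.elim_inr, Pi.single_eq_same]; positivity⟩
  exact le_of_mul_le_mul_right (h2.trans h1) h3

/-- Courant–Fischer lower bound: if the quadratic form of `K ≥ 0` is at least `w` on the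
`l`-dimensional row space of a matrix with `l` rows, then the `l` largest eigenvalues are at
least `w`. -/
theorem eigenvalue_left_ge_of_rowSpace (h : IsSpectralSplit K UL US σL σS)
    (hL : ∀ i, 0 ≤ σL i) (hS : ∀ i, 0 ≤ σS i) {ι : Type*} [Fintype ι]
    (hι : Fintype.card ι = l) (A : Matrix ι (Fin n) ℝ)
    (hA : ∀ y, Aᵀ *ᵥ y = 0 → y = 0) {w : ℝ}
    (hw : ∀ y, w * ((Aᵀ *ᵥ y) ⬝ᵥ (Aᵀ *ᵥ y)) ≤ (Aᵀ *ᵥ y) ⬝ᵥ K *ᵥ (Aᵀ *ᵥ y)) (j : Fin l) :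
    w ≤ σL j := by
  classical
  let F : (ι → ℝ) →ₗ[ℝ] ({i : Fin l // i ≠ j} → ℝ) :=
    (ULᵀ.submatrix (fun i : {i : Fin l // i ≠ j} => (i : Fin l)) id).mulVecLin ∘ₗ Aᵀ.mulVecLin
  obtain ⟨y, hy, hy0⟩ := (LinearMap.ker F).ne_bot_iff.1
    (LinearMap.ker_ne_bot_of_finrank_lt (by
      have := j.pos
      simp [hι]; omega))
  set x := Aᵀ *ᵥ y with hx
  set c := (fromCols UL US)ᵀ *ᵥ x with hc
  have hxc : fromCols UL US *ᵥ c = x := by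
    rw [hc, mulVec_mulVec, h.orthogonal_right, one_mulVec]
  have hc0 : ∀ i, i ≠ j → c (Sum.inl i) = 0 := fun i hi => by
    have h1 := congrFun (show F y = 0 from hy) ⟨i, hi⟩
    rw [hc, transpose_fromCols, fromRows_mulVec, Sum.elim_inl]
    exact h1
  have h1 := hw y
  rw [← hx, ← hxc, h.dotProduct_mulVec_combination, h.dotProduct_self_combination] at h1
  have h2 : ∑ k, Sum.elim σL σS k * c k ^ 2 ≤ σL j * ∑ k, c k ^ 2 := by
    rw [Finset.mul_sum]
    refine Finset.sum_le_sum fun k _ => ?_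
    rcases k with k | k
    · rcases eq_or_ne k j with rfl | hk
      · rfl
      · simp [hc0 k hk]
    · have h3 := h.ordered j k
      rw [abs_of_nonneg (hL j), abs_of_nonneg (hS k)] at h3
      exact mul_le_mul_of_nonneg_right h3 (sq_nonneg _)
  have h3 : 0 < ∑ k, c k ^ 2 := by
    rw [← h.dotProduct_self_combination, hxc, ← norm_toLp_sq]
    have h4 : x ≠ 0 := fun h0 => hy0 (hA y h0)
    have : WithLp.toLp 2 x ≠ 0 := by simpa using h4
    positivity
  exact le_of_mul_le_mul_right (h1.trans h2) h3

end IsSpectralSplit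

/-! ### Orthonormal bases and projections for the row space and the null space. -/

theorem IsOrthonormalBasisMatrix.of_col_mem {n k : ℕ} {M : Matrix (Fin n) (Fin k) ℝ}
    {V : Submodule ℝ (Fin n → ℝ)} (hM : M.transpose * M = 1) (hV : Module.finrank ℝ V = k)
    (hmem : ∀ j, M.col j ∈ V) : IsOrthonormalBasisMatrix M V := by
  refine ⟨hM, ?_⟩
  have hli : LinearIndependent ℝ M.col := by
    rw [← Matrix.mulVec_injective_iff]
    intro x y hxy
    have h1 := congrArg (M.transpose.mulVec) hxy
    simpa only [Matrix.mulVec_mulVec, hM, Matrix.one_mulVec] using h1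
  refine Submodule.eq_of_le_of_finrank_eq (Submodule.span_le.2 ?_) ?_
  · rintro _ ⟨j, rfl⟩
    exact hmem j
  · rw [finrank_span_eq_card hli, hV, Fintype.card_fin]

namespace Matrix

variable {n : ℕ}

/-- Orthonormal columns nearly fixed by an orthogonal projection `Q` are close to
orthonormal columns fixed by `Q`. -/
theorem exists_orthonormal_fixed_near {k : ℕ} (Q : Matrix (Fin n) (Fin n) ℝ) (hQ : Qᵀ = Q)
    (hQQ : Q * Q = Q) (U : Matrix (Fin n) (Fin k) ℝ) (hU : Uᵀ * U = 1) {ε : ℝ}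
    (hε : ε ≤ 1 / 2) (h : ‖(1 - Q) * U‖ ≤ ε) :
    ∃ Z : Matrix (Fin n) (Fin k) ℝ, Zᵀ * Z = 1 ∧ Q * Z = Z ∧ ‖U - Z‖ ≤ 2 * ε := by
  have hε0 : 0 ≤ ε := (norm_nonneg _).trans h
  -- Pythagoras: the Gram defect of $QU$ is quadratic in $(1-Q)U$, at most
  -- $\varepsilon^2\le\varepsilon$. Projection and re-orthonormalization then cost $\varepsilon$
  -- each.
  have h1 : (Q * U)ᵀ * (Q * U) - 1 = -(((1 - Q) * U)ᵀ * ((1 - Q) * U)) := by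
    have h2 : (1 - Q) * (1 - Q) = 1 - Q := by
      simp [Matrix.mul_sub, Matrix.sub_mul, hQQ]
    rw [transpose_mul, transpose_mul, transpose_sub, transpose_one, hQ, Matrix.mul_assoc,
      ← Matrix.mul_assoc Q Q, hQQ, Matrix.mul_assoc, ← Matrix.mul_assoc (1 - Q) (1 - Q), h2,
      Matrix.sub_mul, Matrix.mul_sub, Matrix.one_mul, hU]
    abel
  have h3 : ‖(Q * U)ᵀ * (Q * U) - 1‖ ≤ ε := by
    rw [h1, norm_neg]
    refine (l2_opNorm_mul_le_of_le ((l2_opNorm_transpose _).trans_le h) h).trans ?_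
    nlinarith
  obtain ⟨R, hR, hRn⟩ := exists_orthonormal_mul_right (Q * U) (by linarith) h3
  refine ⟨Q * U * R, hR, by rw [← Matrix.mul_assoc, ← Matrix.mul_assoc, hQQ], ?_⟩
  have h4 : U - Q * U * R = (1 - Q) * U + (Q * U - Q * U * R) := by
    rw [Matrix.sub_mul, Matrix.one_mul]; abel
  rw [h4]
  linarith [norm_add_le ((1 - Q) * U) (Q * U - Q * U * R)]

variable {ι : Type*} [Fintype ι] [DecidableEq ι] {A : Matrix ι (Fin n) ℝ}

/-- The transposed pseudo-inverse of a matrix of full row rank. -/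
noncomputable def rowPinv (A : Matrix ι (Fin n) ℝ) : Matrix ι (Fin n) ℝ := (A * Aᵀ)⁻¹ * A

/-- The orthogonal projection onto the row space of a matrix of full row rank. -/
noncomputable def rowProj (A : Matrix ι (Fin n) ℝ) : Matrix (Fin n) (Fin n) ℝ := Aᵀ * rowPinv A

theorem rowPinv_mul_transpose (hA : IsUnit (A * Aᵀ).det) : rowPinv A * Aᵀ = 1 := by
  rw [rowPinv, Matrix.mul_assoc, nonsing_inv_mul _ hA]

theorem rowPinv_transpose : (rowPinv A)ᵀ = Aᵀ * (A * Aᵀ)⁻¹ := by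
  rw [rowPinv, transpose_mul, transpose_nonsing_inv, transpose_mul, transpose_transpose]

theorem rowProj_transpose : (rowProj A)ᵀ = rowProj A := by
  rw [rowProj, transpose_mul, rowPinv_transpose, transpose_transpose, rowPinv, Matrix.mul_assoc]

theorem rowProj_eq : rowProj A = (rowPinv A)ᵀ * A := by
  rw [← rowProj_transpose, rowProj, transpose_mul, transpose_transpose]

theorem rowProj_mul_transpose (hA : IsUnit (A * Aᵀ).det) : rowProj A * Aᵀ = Aᵀ := by
  rw [rowProj, Matrix.mul_assoc, rowPinv_mul_transpose hA, Matrix.mul_one]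

theorem mul_rowProj (hA : IsUnit (A * Aᵀ).det) : A * rowProj A = A := by
  have h := congrArg transpose (rowProj_mul_transpose hA)
  rwa [transpose_mul, transpose_transpose, rowProj_transpose] at h

theorem rowProj_mul_self (hA : IsUnit (A * Aᵀ).det) : rowProj A * rowProj A = rowProj A := by
  nth_rw 1 [rowProj_eq]
  rw [Matrix.mul_assoc, mul_rowProj hA, ← rowProj_eq]

/-- A symmetric idempotent $P$ satisfies $\|P\|^2=\|P^\top P\|=\|P\|$. -/
theorem norm_one_sub_rowProj_le (hA : IsUnit (A * Aᵀ).det) : ‖1 - rowProj A‖ ≤ 1 := by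
  have h : (1 - rowProj A)ᵀ * (1 - rowProj A) = 1 - rowProj A := by
    rw [transpose_sub, transpose_one, rowProj_transpose]
    simp [Matrix.mul_sub, Matrix.sub_mul, rowProj_mul_self hA]
  have h2 := l2_opNorm_conjTranspose_mul_self (1 - rowProj A)
  rw [conjTranspose_eq_transpose_of_trivial, h] at h2
  nlinarith [norm_nonneg (1 - rowProj A)]

theorem finrank_range_transpose (hA : IsUnit (A * Aᵀ).det) :
    Module.finrank ℝ (LinearMap.range Aᵀ.mulVecLin) = Fintype.card ι := by
  rw [LinearMap.finrank_range_of_inj, Module.finrank_fintype_fun_eq_card]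
  intro x y hxy
  have h := congrArg (rowPinv A *ᵥ ·) (show Aᵀ *ᵥ x = Aᵀ *ᵥ y from hxy)
  simpa only [mulVec_mulVec, rowPinv_mul_transpose hA, one_mulVec] using h

theorem finrank_ker_mulVecLin (hA : IsUnit (A * Aᵀ).det) :
    Module.finrank ℝ (LinearMap.ker A.mulVecLin) = n - Fintype.card ι := by
  have h := LinearMap.finrank_range_add_finrank_ker A.mulVecLin
  have h2 : LinearMap.range A.mulVecLin = ⊤ := by
    refine LinearMap.range_eq_top.2 fun y => ⟨(rowPinv A)ᵀ *ᵥ y, ?_⟩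
    rw [mulVecLin_apply, mulVec_mulVec, rowPinv_transpose, ← Matrix.mul_assoc,
      mul_nonsing_inv _ hA, one_mulVec]
  rw [h2, finrank_top, Module.finrank_fintype_fun_eq_card, Module.finrank_fintype_fun_eq_card,
    Fintype.card_fin] at h
  omega

theorem isOrthonormalBasisMatrix_range (hA : IsUnit (A * Aᵀ).det) {k : ℕ}
    (hk : Fintype.card ι = k) {Y : Matrix (Fin n) (Fin k) ℝ} (hY : Yᵀ * Y = 1)
    (hQ : rowProj A * Y = Y) :
    IsOrthonormalBasisMatrix Y (LinearMap.range Aᵀ.mulVecLin) := by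
  refine .of_col_mem hY (by rw [finrank_range_transpose hA, hk]) fun j =>
    ⟨(rowPinv A * Y).col j, ?_⟩
  conv_rhs => rw [← hQ, rowProj, Matrix.mul_assoc]
  rfl

theorem isOrthonormalBasisMatrix_ker (hA : IsUnit (A * Aᵀ).det) {k : ℕ}
    (hk : n - Fintype.card ι = k) {Z : Matrix (Fin n) (Fin k) ℝ} (hZ : Zᵀ * Z = 1)
    (hQ : (1 - rowProj A) * Z = Z) :
    IsOrthonormalBasisMatrix Z (LinearMap.ker A.mulVecLin) := by
  refine .of_col_mem hZ (by rw [finrank_ker_mulVecLin hA, hk]) fun j => ?_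
  have h : A * Z = 0 := by
    rw [← hQ, ← Matrix.mul_assoc, Matrix.mul_sub, mul_rowProj hA]; simp
  exact congrFun (congrArg col h) j

end Matrix

/-! ### Perturbation bounds for $A^\top DA+E$. -/

namespace IsSpectralSplit

open Matrix

variable {n l : ℕ} {K : Matrix (Fin n) (Fin n) ℝ} {UL : Matrix (Fin n) (Fin l) ℝ}
  {US : Matrix (Fin n) (Fin (n - l)) ℝ} {σL : Fin l → ℝ} {σS : Fin (n - l) → ℝ}
  {ι : Type*} [Fintype ι] [DecidableEq ι] {A : Matrix ι (Fin n) ℝ} {D : ι → ℝ}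
  {E : Matrix (Fin n) (Fin n) ℝ} {β δ w : ℝ}

/-- On $\ker A$ the form of $K$ is that of $E$, so the remaining eigenvalues are at most $w$.
Applying `rowPinv A` to $KU_S=U_S\Sigma_S$ cancels $A^\top$ and isolates $DAU_S$; dividing by $D$
gains the factor $\delta$. -/
theorem norm_mul_right_le (h : IsSpectralSplit K UL US σL σS)
    (hpos : ∀ x, 0 ≤ x ⬝ᵥ K *ᵥ x) (hι : Fintype.card ι = l)
    (hA : IsUnit (A * Aᵀ).det) (hβ : ‖rowPinv A‖ ≤ β) (hK : K = Aᵀ * diagonal D * A + E)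
    (hE : ‖E‖ ≤ w) (hD : ∀ i, 0 < D i) (hδ : ∀ i, (D i)⁻¹ ≤ δ) (hδ0 : 0 ≤ δ) :
    ‖A * US‖ ≤ δ * (β * (2 * w)) := by
  have hw0 : 0 ≤ w := (norm_nonneg _).trans hE
  have hS0 : ∀ i, 0 ≤ σS i := h.eigenvalue_right_ge (by simpa using hpos)
  have hS : ‖σS‖ ≤ w := by
    refine (pi_norm_le_iff_of_nonneg hw0).2 fun j => ?_
    rw [Real.norm_of_nonneg (hS0 j)]
    refine h.eigenvalue_right_le (h.eigenvalue_left_ge (by simpa using hpos)) hS0 hι A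
      (fun x hx => ?_) j
    have h1 : K *ᵥ x = E *ᵥ x := by
      rw [hK, add_mulVec, ← mulVec_mulVec, hx, mulVec_zero, zero_add]
    rw [h1]
    have h0 : 0 ≤ x ⬝ᵥ x := by rw [← norm_toLp_sq]; positivity
    exact (le_abs_self _).trans ((abs_dotProduct_mulVec_le E x).trans (by gcongr))
  have h1 : A * US = diagonal (fun i => (D i)⁻¹) * (rowPinv A * (US * diagonal σS - E * US)) := by
    rw [← h.mul_right, hK, Matrix.add_mul, add_sub_cancel_right, Matrix.mul_assoc, Matrix.mul_assoc,
      ← Matrix.mul_assoc (rowPinv A), rowPinv_mul_transpose hA, Matrix.one_mul, ← Matrix.mul_assoc,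
      diagonal_mul_diagonal]
    simp [fun i => inv_mul_cancel₀ (hD i).ne']
  rw [h1]
  have hUS := l2_opNorm_le_one_of_transpose_mul_self h.gram_right
  refine l2_opNorm_mul_le_of_le ?_ (l2_opNorm_mul_le_of_le hβ ?_)
  · rw [l2_opNorm_diagonal]
    refine (pi_norm_le_iff_of_nonneg hδ0).2 fun i => ?_
    rw [Real.norm_of_nonneg (inv_pos.2 (hD i)).le]
    exact hδ i
  · have h2 : ‖US * diagonal σS‖ ≤ 1 * w :=
      l2_opNorm_mul_le_of_le hUS (by rwa [l2_opNorm_diagonal])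
    have h3 : ‖E * US‖ ≤ w * 1 := l2_opNorm_mul_le_of_le hE hUS
    linarith [norm_sub_le (US * diagonal σS) (E * US)]

/-- On the row space $|x|\le\beta|Ax|$, so the form of $K$ is at least
$((\delta\beta^2)^{-1}-w)|x|^2$. The smallness condition lets $w$ consume at most half of the
leading term. -/
theorem inv_eigenvalue_left_le (h : IsSpectralSplit K UL US σL σS)
    (hpos : ∀ x, 0 ≤ x ⬝ᵥ K *ᵥ x) (hι : Fintype.card ι = l)
    (hA : IsUnit (A * Aᵀ).det) (hβ : ‖rowPinv A‖ ≤ β) (hβ0 : 0 < β)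
    (hK : K = Aᵀ * diagonal D * A + E)
    (hE : ‖E‖ ≤ w) (hD : ∀ i, 0 < D i) (hδ : ∀ i, (D i)⁻¹ ≤ δ) (hδ0 : 0 < δ)
    (hsmall : 2 * w * (δ * β ^ 2) ≤ 1) (j : Fin l) :
    0 < σL j ∧ (σL j)⁻¹ ≤ 2 * (δ * β ^ 2) := by
  have hq : 0 < δ * β ^ 2 := by positivity
  have h1 : (δ * β ^ 2)⁻¹ - w ≤ σL j := by
    refine h.eigenvalue_left_ge_of_rowSpace (h.eigenvalue_left_ge (by simpa using hpos))
      (h.eigenvalue_right_ge (by simpa using hpos)) hι A (fun y hy => ?_) (fun y => ?_) j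
    · have h2 := congrArg (rowPinv A *ᵥ ·) hy
      simpa only [mulVec_mulVec, rowPinv_mul_transpose hA, one_mulVec, mulVec_zero] using h2
    · set x := Aᵀ *ᵥ y with hx
      have hx1 : (rowPinv A)ᵀ *ᵥ (A *ᵥ x) = x := by
        rw [mulVec_mulVec, ← rowProj_eq, hx, mulVec_mulVec, rowProj_mul_transpose hA]
      have h0 : 0 ≤ x ⬝ᵥ x := by rw [← norm_toLp_sq]; positivity
      have h0' : 0 ≤ (A *ᵥ x) ⬝ᵥ (A *ᵥ x) := by rw [← norm_toLp_sq]; positivity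
      have h3 : x ⬝ᵥ x ≤ β ^ 2 * ((A *ᵥ x) ⬝ᵥ (A *ᵥ x)) := by
        have h4 := mulVec_dotProduct_self_le (rowPinv A)ᵀ (A *ᵥ x)
        rw [hx1, l2_opNorm_transpose] at h4
        exact h4.trans (by gcongr)
      have h5 : δ⁻¹ * ((A *ᵥ x) ⬝ᵥ (A *ᵥ x)) ≤ (A *ᵥ x) ⬝ᵥ (diagonal D *ᵥ (A *ᵥ x)) := by
        simp only [dotProduct, Finset.mul_sum, mulVec_diagonal]
        refine Finset.sum_le_sum fun i _ => ?_
        have h6 : δ⁻¹ ≤ D i := inv_le_of_inv_le₀ (hD i) (hδ i)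
        nlinarith [mul_le_mul_of_nonneg_right h6 (mul_self_nonneg ((A *ᵥ x) i))]
      have h7 : x ⬝ᵥ K *ᵥ x = (A *ᵥ x) ⬝ᵥ (diagonal D *ᵥ (A *ᵥ x)) + x ⬝ᵥ E *ᵥ x := by
        rw [hK, add_mulVec, dotProduct_add, Matrix.mul_assoc, ← mulVec_mulVec, ← mulVec_mulVec,
          dotProduct_mulVec x, vecMul_transpose]
      have h8 := neg_abs_le (x ⬝ᵥ E *ᵥ x)
      have h9 : |x ⬝ᵥ E *ᵥ x| ≤ w * (x ⬝ᵥ x) :=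
        (abs_dotProduct_mulVec_le E x).trans (by gcongr)
      have h10 : (δ * β ^ 2)⁻¹ * (x ⬝ᵥ x) ≤ δ⁻¹ * ((A *ᵥ x) ⬝ᵥ (A *ᵥ x)) := by
        rw [mul_inv, mul_assoc]
        refine mul_le_mul_of_nonneg_left ?_ (by positivity)
        rw [inv_mul_le_iff₀ (by positivity)]
        exact h3
      rw [h7]
      linarith
  have h2 : (2 * (δ * β ^ 2))⁻¹ ≤ σL j := by
    refine le_trans ?_ h1
    have h3 : w ≤ (2 * (δ * β ^ 2))⁻¹ := by
      rw [← one_div, le_div_iff₀ (by positivity)]; linarith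
    have h4 : (δ * β ^ 2)⁻¹ = 2 * (2 * (δ * β ^ 2))⁻¹ := by field_simp
    linarith
  have h3 : 0 < σL j := lt_of_lt_of_le (by positivity) h2
  exact ⟨h3, inv_le_of_inv_le₀ (by positivity) h2⟩

/-- The projection $1-Q$ annihilates $A^\top$, so only $E$ survives in $(1-Q)K$; substitute
$U_L=KU_L\Sigma_L^{-1}$. -/
theorem norm_one_sub_rowProj_mul_left_le (h : IsSpectralSplit K UL US σL σS)
    (hA : IsUnit (A * Aᵀ).det) (hK : K = Aᵀ * diagonal D * A + E) (hE : ‖E‖ ≤ w)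
    {τ : ℝ} (hτ0 : 0 ≤ τ) (hτ : ∀ j, 0 < σL j ∧ (σL j)⁻¹ ≤ τ) :
    ‖(1 - rowProj A) * UL‖ ≤ w * τ := by
  have h1 : (1 - rowProj A) * UL =
      (1 - rowProj A) * (E * (UL * diagonal fun j => (σL j)⁻¹)) := by
    have h2 : UL = UL * diagonal σL * diagonal fun j => (σL j)⁻¹ := by
      rw [Matrix.mul_assoc, diagonal_mul_diagonal]
      simp [fun i => mul_inv_cancel₀ (hτ i).1.ne']
    have h3 : (1 - rowProj A) * K = (1 - rowProj A) * E := by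
      rw [hK, Matrix.mul_add, ← Matrix.mul_assoc, ← Matrix.mul_assoc, Matrix.sub_mul _ _ Aᵀ,
        rowProj_mul_transpose hA]
      simp
    conv_lhs => rw [h2, ← h.mul_left, Matrix.mul_assoc, ← Matrix.mul_assoc, h3]
    rw [Matrix.mul_assoc]
  rw [h1]
  have h4 : ‖diagonal fun j => (σL j)⁻¹‖ ≤ τ := by
    rw [l2_opNorm_diagonal]
    refine (pi_norm_le_iff_of_nonneg hτ0).2 fun i => ?_
    rw [Real.norm_of_nonneg (inv_pos.2 (hτ i).1).le]
    exact (hτ i).2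
  have h5 := l2_opNorm_mul_le_of_le (norm_one_sub_rowProj_le hA) (l2_opNorm_mul_le_of_le hE
    (l2_opNorm_mul_le_of_le (l2_opNorm_le_one_of_transpose_mul_self h.gram_left) h4))
  linarith

end IsSpectralSplit

namespace Matrix

theorem l2_opNorm_le_fromRows_right {m₁ m₂ k : Type*} [Fintype m₁] [Fintype m₂] [Fintype k]
    [DecidableEq k] (M₁ : Matrix m₁ k ℝ) (M₂ : Matrix m₂ k ℝ) : ‖M₂‖ ≤ ‖fromRows M₁ M₂‖ := by
  refine l2_opNorm_le_of_mulVec_dotProduct_self_le _ (norm_nonneg _) fun x => ?_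
  refine le_trans ?_ (mulVec_dotProduct_self_le (fromRows M₁ M₂) x)
  rw [fromRows_mulVec, sumElim_dotProduct_sumElim]
  have h : 0 ≤ M₁ *ᵥ x ⬝ᵥ M₁ *ᵥ x := by rw [← norm_toLp_sq]; positivity
  linarith

end Matrix

namespace IsSpectralSplit

open Matrix

variable {n l : ℕ} {K : Matrix (Fin n) (Fin n) ℝ} {UL : Matrix (Fin n) (Fin l) ℝ}
  {US : Matrix (Fin n) (Fin (n - l)) ℝ} {σL : Fin l → ℝ} {σS : Fin (n - l) → ℝ}
  {ι : Type*} [Fintype ι] [DecidableEq ι] {A : Matrix ι (Fin n) ℝ} {D : ι → ℝ}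
  {E : Matrix (Fin n) (Fin n) ℝ} {β δ w : ℝ}

/-- The dominant and the remaining eigenvectors of `Aᵀ D A + E` are close to orthonormal bases of
the row space and of the null space of `A`. -/
theorem exists_bases_near (h : IsSpectralSplit K UL US σL σS)
    (hpos : ∀ x, 0 ≤ x ⬝ᵥ K *ᵥ x) (hι : Fintype.card ι = l)
    (hA : IsUnit (A * Aᵀ).det) (hβ : ‖rowPinv A‖ ≤ β) (hβ0 : 0 < β)
    (hK : K = Aᵀ * diagonal D * A + E)
    (hE : ‖E‖ ≤ w) (hD : ∀ i, 0 < D i) (hδ : ∀ i, (D i)⁻¹ ≤ δ) (hδ0 : 0 < δ)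
    (hsmall : 2 * w * (δ * β ^ 2) ≤ 1 / 2) :
    ∃ (Y : Matrix (Fin n) (Fin l) ℝ) (Z : Matrix (Fin n) (Fin (n - l)) ℝ),
      IsOrthonormalBasisMatrix Y (LinearMap.range Aᵀ.mulVecLin) ∧
      IsOrthonormalBasisMatrix Z (LinearMap.ker A.mulVecLin) ∧
      ‖UL - Y‖ ≤ 4 * w * β ^ 2 * δ ∧ ‖US - Z‖ ≤ 4 * w * β ^ 2 * δ := by
  have h1 : ‖(1 - rowProj A) * UL‖ ≤ 2 * w * (δ * β ^ 2) :=
    (h.norm_one_sub_rowProj_mul_left_le hA hK hE (by positivity)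
      (h.inv_eigenvalue_left_le hpos hι hA hβ hβ0 hK hE hD hδ hδ0 (by linarith))).trans
      (by linarith)
  -- The row-space component of $U_S$ is `(rowPinv A)ᵀ` applied to $AU_S$, which is already small.
  have h2 : ‖(1 - (1 - rowProj A)) * US‖ ≤ 2 * w * (δ * β ^ 2) := by
    rw [sub_sub_cancel, rowProj_eq, Matrix.mul_assoc]
    refine (l2_opNorm_mul_le_of_le ((l2_opNorm_transpose _).trans_le hβ)
      (h.norm_mul_right_le hpos hι hA hβ hK hE hD hδ hδ0.le)).trans (by linarith)
  obtain ⟨Y, hY, hYQ, hYn⟩ := exists_orthonormal_fixed_near (rowProj A) rowProj_transpose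
    (rowProj_mul_self hA) UL h.gram_left hsmall h1
  obtain ⟨Z, hZ, hZQ, hZn⟩ := exists_orthonormal_fixed_near (1 - rowProj A)
    (by rw [transpose_sub, transpose_one, rowProj_transpose])
    (by simp [Matrix.mul_sub, Matrix.sub_mul, rowProj_mul_self hA]) US h.gram_right hsmall h2
  exact ⟨Y, Z, isOrthonormalBasisMatrix_range hA hι hY hYQ,
    isOrthonormalBasisMatrix_ker hA (by rw [hι]) hZ hZQ, by linarith, by linarith⟩

theorem inv_diagonal_left (hL : ∀ i, 0 < σL i) :
    (diagonal σL)⁻¹ = diagonal fun i => (σL i)⁻¹ :=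
  inv_eq_left_inv (by
    rw [diagonal_mul_diagonal]
    simp [fun i => inv_mul_cancel₀ (hL i).ne'])

theorem inv_eq (h : IsSpectralSplit K UL US σL σS) (hL : ∀ i, 0 < σL i) (hS : ∀ i, 0 < σS i) :
    K⁻¹ = UL * diagonal (fun i => (σL i)⁻¹) * ULᵀ + US * diagonal (fun i => (σS i)⁻¹) * USᵀ := by
  refine inv_eq_right_inv ?_
  rw [Matrix.mul_add, ← Matrix.mul_assoc, ← Matrix.mul_assoc, h.mul_left, ← Matrix.mul_assoc,
    ← Matrix.mul_assoc, h.mul_right, Matrix.mul_assoc UL, Matrix.mul_assoc US,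
    diagonal_mul_diagonal, diagonal_mul_diagonal]
  simp only [fun i => mul_inv_cancel₀ (hL i).ne', fun i => mul_inv_cancel₀ (hS i).ne']
  simpa [transpose_fromCols, fromCols_mul_fromRows] using h.orthogonal_right

/-- Approximation of the Schur complement of `Aᵀ D A + E` by the dominant eigenpairs. -/
theorem norm_schur_sub_le (h : IsSpectralSplit K UL US σL σS) {κ : ℝ} (hκ : 0 < κ)
    (hpos : ∀ x, κ * (x ⬝ᵥ x) ≤ x ⬝ᵥ K *ᵥ x) (hι : Fintype.card ι = l)
    (hA : IsUnit (A * Aᵀ).det) (hβ : ‖rowPinv A‖ ≤ β) (hβ0 : 0 < β)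
    (hK : K = Aᵀ * diagonal D * A + E)
    (hE : ‖E‖ ≤ w) (hD : ∀ i, 0 < D i) (hδ : ∀ i, (D i)⁻¹ ≤ δ) (hδ0 : 0 < δ)
    (hsmall : 2 * w * (δ * β ^ 2) ≤ 1) {me : ℕ} {G : Matrix (Fin me) (Fin n) ℝ} {η : ℝ}
    (hG : ‖G‖ ≤ η) (hGA : ‖G * US‖ ≤ ‖A * US‖) {Y : Matrix (Fin n) (Fin l) ℝ}
    (hY : Yᵀ * Y = 1) {ε : ℝ} (hε : ‖UL - Y‖ ≤ ε) :
    ‖G * K⁻¹ * Gᵀ - G * Y * (diagonal σL)⁻¹ * Yᵀ * Gᵀ‖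
      ≤ 4 * η ^ 2 * β ^ 2 * (ε * δ) + 4 * w ^ 2 * β ^ 2 * κ⁻¹ * δ ^ 2 := by
  have hη0 : 0 ≤ η := (norm_nonneg _).trans hG
  have hw0 : 0 ≤ w := (norm_nonneg _).trans hE
  have hpos' : ∀ x, 0 ≤ x ⬝ᵥ K *ᵥ x := fun x =>
    le_trans (by rw [← norm_toLp_sq]; positivity) (hpos x)
  have hL := h.inv_eigenvalue_left_le hpos' hι hA hβ hβ0 hK hE hD hδ hδ0 hsmall
  have hS : ∀ i, κ ≤ σS i := h.eigenvalue_right_ge hpos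
  have hS0 : ∀ i, 0 < σS i := fun i => hκ.trans_le (hS i)
  set T := diagonal fun i => (σL i)⁻¹
  set R := diagonal fun i => (σS i)⁻¹
  have hT : ‖T‖ ≤ 2 * (δ * β ^ 2) := by
    rw [l2_opNorm_diagonal]
    refine (pi_norm_le_iff_of_nonneg (by positivity)).2 fun i => ?_
    rw [Real.norm_of_nonneg (inv_pos.2 (hL i).1).le]
    exact (hL i).2
  have hR : ‖R‖ ≤ κ⁻¹ := by
    rw [l2_opNorm_diagonal]
    refine (pi_norm_le_iff_of_nonneg (by positivity)).2 fun i => ?_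
    rw [Real.norm_of_nonneg (inv_pos.2 (hS0 i)).le]
    exact inv_anti₀ hκ (hS i)
  -- Telescoping $U_LTU_L^\top-YTY^\top$ leaves two terms of size $\varepsilon\|T\|$. In the last
  -- term each factor $GU_S$ contributes one power of $\delta$.
  have hsplit : G * K⁻¹ * Gᵀ - G * Y * (diagonal σL)⁻¹ * Yᵀ * Gᵀ =
      G * (UL - Y) * (T * (ULᵀ * Gᵀ)) + G * (Y * (T * ((UL - Y)ᵀ * Gᵀ)))
        + G * US * (R * (G * US)ᵀ) := by
    rw [inv_diagonal_left fun i => (hL i).1, h.inv_eq (fun i => (hL i).1) hS0]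
    simp only [transpose_mul, transpose_sub, Matrix.mul_sub, Matrix.sub_mul, Matrix.mul_add,
      Matrix.add_mul, Matrix.mul_assoc]
    abel
  have hG' : ‖Gᵀ‖ ≤ η := (l2_opNorm_transpose G).trans_le hG
  have hU : ‖ULᵀ‖ ≤ 1 :=
    (l2_opNorm_transpose UL).trans_le (l2_opNorm_le_one_of_transpose_mul_self h.gram_left)
  have hε' : ‖(UL - Y)ᵀ‖ ≤ ε := (l2_opNorm_transpose _).trans_le hε
  have hGU := hGA.trans (h.norm_mul_right_le hpos' hι hA hβ hK hE hD hδ hδ0.le)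
  have hGU' := (l2_opNorm_transpose (G * US)).trans_le hGU
  have h1 := l2_opNorm_mul_le_of_le (l2_opNorm_mul_le_of_le hG hε)
    (l2_opNorm_mul_le_of_le hT (l2_opNorm_mul_le_of_le hU hG'))
  have h2 := l2_opNorm_mul_le_of_le hG (l2_opNorm_mul_le_of_le
    (l2_opNorm_le_one_of_transpose_mul_self hY)
    (l2_opNorm_mul_le_of_le hT (l2_opNorm_mul_le_of_le hε' hG')))
  have h3 := l2_opNorm_mul_le_of_le hGU (l2_opNorm_mul_le_of_le hR hGU')
  rw [hsplit]
  refine (norm_add₃_le.trans (add_le_add_three h1 h2 h3)).trans (le_of_eq ?_)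
  ring

end IsSpectralSplit

/-! ### Positivity by penalization. -/

namespace Matrix

/-- Finsler's lemma. -/
theorem exists_penalty_pos {n : ℕ} {ι : Type*} [Fintype ι] (W : Matrix (Fin n) (Fin n) ℝ)
    (A : Matrix ι (Fin n) ℝ) (h : ∀ d, d ≠ 0 → A *ᵥ d = 0 → 0 < d ⬝ᵥ W *ᵥ d) :
    ∃ ρ κ : ℝ, 0 ≤ ρ ∧ 0 < κ ∧
      ∀ x, κ * (x ⬝ᵥ x) ≤ x ⬝ᵥ W *ᵥ x + ρ * (A *ᵥ x ⬝ᵥ A *ᵥ x) := by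
  let q : ℕ → EuclideanSpace ℝ (Fin n) → ℝ := fun k x =>
    x.ofLp ⬝ᵥ W *ᵥ x.ofLp + k * (A *ᵥ x.ofLp ⬝ᵥ A *ᵥ x.ofLp)
  have hAnn : ∀ x, 0 ≤ A *ᵥ x ⬝ᵥ A *ᵥ x := fun x => by rw [← norm_toLp_sq]; positivity
  have hqc : ∀ k, Continuous (q k) := fun k => by
    have h0 : Continuous fun x : EuclideanSpace ℝ (Fin n) => x.ofLp :=
      PiLp.continuous_ofLp 2 _
    have hA : Continuous fun x : EuclideanSpace ℝ (Fin n) => A *ᵥ x.ofLp :=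
      continuous_const.matrix_mulVec h0
    have hW : Continuous fun x : EuclideanSpace ℝ (Fin n) => W *ᵥ x.ofLp :=
      continuous_const.matrix_mulVec h0
    exact (h0.dotProduct hW).add (continuous_const.mul (hA.dotProduct hA))
  -- These open sets increase with $k$ and cover the sphere: on $\ker A$ the form of $W$ is
  -- positive, and elsewhere the penalty eventually dominates. By compactness a single $k$ provides
  -- both the penalty $k$ and the margin $1/(k+1)$.
  obtain ⟨k, hk⟩ := (isCompact_sphere (0 : EuclideanSpace ℝ (Fin n)) 1).elim_directed_cover
    (fun k : ℕ => {x | 1 / ((k : ℝ) + 1) < q k x})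
    (fun k => isOpen_lt continuous_const (hqc k))
    (fun x hx => by
      have hx0 : x ≠ 0 := by rintro rfl; simp at hx
      have hx0' : x.ofLp ≠ 0 := by simpa using hx0
      rw [Set.mem_iUnion]
      by_cases hAx : A *ᵥ x.ofLp = 0
      · obtain ⟨k, hk⟩ := exists_nat_one_div_lt (h _ hx0' hAx)
        exact ⟨k, by simpa [q, hAx] using hk⟩
      · have hb : 0 < A *ᵥ x.ofLp ⬝ᵥ A *ᵥ x.ofLp := by
          rw [← norm_toLp_sq]
          have : WithLp.toLp 2 (A *ᵥ x.ofLp) ≠ 0 := by simpa using hAx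
          positivity
        obtain ⟨k, hk⟩ := exists_nat_gt ((1 - x.ofLp ⬝ᵥ W *ᵥ x.ofLp) /
          (A *ᵥ x.ofLp ⬝ᵥ A *ᵥ x.ofLp))
        refine ⟨k, ?_⟩
        rw [div_lt_iff₀ hb] at hk
        have h2 : 1 / ((k : ℝ) + 1) ≤ 1 := by
          rw [div_le_one (by positivity)]; linarith [Nat.cast_nonneg (α := ℝ) k]
        simp only [Set.mem_ofPred_eq, q]
        linarith)
    (directed_of_isDirected_le fun a b hab x hx => by
      have h1 : (a : ℝ) ≤ b := by exact_mod_cast hab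
      have h2 : 1 / ((b : ℝ) + 1) ≤ 1 / ((a : ℝ) + 1) := by gcongr
      have h3 := mul_le_mul_of_nonneg_right h1 (hAnn x.ofLp)
      simp only [Set.mem_ofPred_eq, q] at hx ⊢
      linarith)
  refine ⟨k, 1 / ((k : ℝ) + 1), by positivity, by positivity, fun x => ?_⟩
  rcases eq_or_ne x 0 with rfl | hx
  · simp
  -- Both sides are homogeneous of degree two, so the bound on the sphere extends by scaling.
  set t := ‖WithLp.toLp 2 x‖ with ht
  have ht0 : 0 < t := norm_pos_iff.2 (by simpa using hx)
  have h1 := hk (show t⁻¹ • WithLp.toLp 2 x ∈ Metric.sphere (0 : EuclideanSpace ℝ (Fin n)) 1 by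
    simp [norm_smul, ← ht, abs_of_pos ht0, ht0.ne'])
  simp only [Set.mem_ofPred_eq, q, WithLp.ofLp_smul, mulVec_smul, smul_dotProduct, dotProduct_smul,
    smul_eq_mul] at h1
  rw [← norm_toLp_sq, ← ht]
  have h2 := mul_le_mul_of_nonneg_left h1.le (sq_nonneg t)
  have h3 : t ^ 2 * (t⁻¹ * (t⁻¹ * (x ⬝ᵥ W *ᵥ x)) + k * (t⁻¹ * (t⁻¹ * (A *ᵥ x ⬝ᵥ A *ᵥ x))))
      = x ⬝ᵥ W *ᵥ x + k * (A *ᵥ x ⬝ᵥ A *ᵥ x) := by field_simp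
  linarith

end Matrix

/-! ### Symmetry, continuity and neighbourhoods for the problem data. -/

open Matrix Filter Topology



theorem hessianMatrix_transpose {n : ℕ} {φ : EuclideanSpace ℝ (Fin n) → ℝ} (hφ : ContDiff ℝ 2 φ)
    (x : EuclideanSpace ℝ (Fin n)) : (hessianMatrix φ x)ᵀ = hessianMatrix φ x := by
  have hd : DifferentiableAt ℝ (fderiv ℝ φ) x :=
    ((hφ.fderiv_right (m := 1) (by norm_num)).differentiable (by norm_num)).differentiableAt
  have h1 : ∀ i j, hessianMatrix φ x i j =
      fderiv ℝ (fderiv ℝ φ) x (EuclideanSpace.single j 1) (EuclideanSpace.single i 1) := by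
    intro i j
    simp only [hessianMatrix, of_apply]
    rw [fderiv_clm_apply hd (differentiableAt_const _)]
    simp
  have hs : IsSymmSndFDerivAt ℝ φ x := hφ.contDiffAt.isSymmSndFDerivAt (by simp)
  ext i j
  rw [transpose_apply, h1, h1]
  exact hs _ _

theorem continuous_jacobian {n m : ℕ} {φ : EuclideanSpace ℝ (Fin n) → EuclideanSpace ℝ (Fin m)}
    (hφ : ContDiff ℝ 2 φ) : Continuous (jacobian φ) := by
  refine continuous_matrix fun i j => ?_
  have h : Continuous (fderiv ℝ φ) := hφ.continuous_fderiv (by norm_num)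
  exact (PiLp.continuous_apply 2 _ i).comp (h.clm_apply continuous_const)

namespace PrimalDual

variable {n me mi : ℕ}

theorem continuous_x : Continuous (x : PrimalDual n me mi → _) :=
  (PiLp.continuous_toLp 2 _).comp (continuous_pi fun i => PiLp.continuous_apply 2 _ (Sum.inl i))

theorem continuous_s : Continuous (s : PrimalDual n me mi → _) :=
  (PiLp.continuous_toLp 2 _).comp
    (continuous_pi fun i => PiLp.continuous_apply 2 _ (Sum.inr (Sum.inl i)))

end PrimalDual

namespace NLP

variable {n me mi : ℕ} {P : NLP n me mi}

theorem W_transpose (hf : ContDiff ℝ 2 P.f) (hg : ContDiff ℝ 2 P.g) (hh : ContDiff ℝ 2 P.h)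
    (p : PrimalDual n me mi) (v : EuclideanSpace ℝ (Fin mi)) : (P.W p v)ᵀ = P.W p v :=
  hessianMatrix_transpose (((hf.add (contDiff_const.inner ℝ hg)).add
    (contDiff_const.inner ℝ (hh.add contDiff_const))).sub contDiff_const) _

/-- The multiplier $v$ enters only through $-v^\top s$, constant in $x$. Regularity stated at the
fixed $v^\star$ therefore controls $W$ at every $v$. -/
theorem W_congr_multiplier (p : PrimalDual n me mi) (v v' : EuclideanSpace ℝ (Fin mi)) :
    P.W p v = P.W p v' := by
  simp only [W, hessianMatrix, lagrangianAt, fderiv_sub_const]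

theorem IsRegular.continuousAt_W {p : PrimalDual n me mi} {v : EuclideanSpace ℝ (Fin mi)}
    (h : P.IsRegular p v) : ContinuousAt (fun q => P.W q v) p := by
  obtain ⟨k, t, ht, hL⟩ := h.lipschitz
  exact hL.continuousOn.continuousAt ht

theorem continuous_activeJacobian (hg : ContDiff ℝ 2 P.g) (hh : ContDiff ℝ 2 P.h)
    (B : Finset (Fin mi)) : Continuous (P.activeJacobian B) := by
  refine continuous_matrix fun i j => ?_
  rcases i with i | i
  · exact (((continuous_jacobian hh).comp PrimalDual.continuous_x).matrix_elem _ _)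
  · exact (((continuous_jacobian hg).comp PrimalDual.continuous_x).matrix_elem _ _)

end NLP

namespace Matrix

theorem isUnit_det_mul_transpose {ι : Type*} [Fintype ι] [DecidableEq ι] {n : ℕ}
    {A : Matrix ι (Fin n) ℝ} (hA : LinearIndependent ℝ A.row) : IsUnit (A * Aᵀ).det := by
  have h := PosDef.mul_conjTranspose_self A (vecMul_injective_iff.2 hA)
  rw [conjTranspose_eq_transpose_of_trivial] at h
  exact h.det_pos.ne'.isUnit

theorem continuousAt_rowPinv {ι : Type*} [Fintype ι] [DecidableEq ι] {n : ℕ}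
    {A : Matrix ι (Fin n) ℝ} (hA : IsUnit (A * Aᵀ).det) :
    ContinuousAt (rowPinv : Matrix ι (Fin n) ℝ → Matrix ι (Fin n) ℝ) A := by
  have hAA : Continuous fun M : Matrix ι (Fin n) ℝ => M * Mᵀ :=
    continuous_id.matrix_mul continuous_id.matrix_transpose
  have hinv : ContinuousAt (fun M : Matrix ι (Fin n) ℝ => (M * Mᵀ)⁻¹) A := by
    simp only [inv_def, Ring.inverse_eq_inv']
    exact (hAA.matrix_det.continuousAt.inv₀ hA.ne_zero).smul hAA.matrix_adjugate.continuousAt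
  have hmul : Continuous fun q : Matrix ι ι ℝ × Matrix ι (Fin n) ℝ => q.1 * q.2 :=
    continuous_fst.matrix_mul continuous_snd
  exact hmul.continuousAt.comp₂ hinv continuousAt_id

theorem eventually_rowPinv_le {X ι : Type*} [TopologicalSpace X] [Fintype ι] [DecidableEq ι]
    {n : ℕ} {A : X → Matrix ι (Fin n) ℝ} {x : X} (hA : Continuous A)
    (hx : IsUnit (A x * (A x)ᵀ).det) :
    ∀ᶠ y in 𝓝 x, IsUnit (A y * (A y)ᵀ).det ∧ ‖rowPinv (A y)‖ ≤ ‖rowPinv (A x)‖ + 1 := by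
  have hdet : Continuous fun y => (A y * (A y)ᵀ).det :=
    (hA.matrix_mul hA.matrix_transpose).matrix_det
  have hP : ContinuousAt (fun y => rowPinv (A y)) x :=
    (continuousAt_rowPinv hx).comp hA.continuousAt
  filter_upwards [hdet.continuousAt.eventually_ne hx.ne_zero,
    hP.norm.eventually_lt_const (lt_add_one _)] with y h1 h2
  exact ⟨h1.isUnit, h2.le⟩

end Matrix

/-- The product type carries the maximum metric, which the Euclidean distance dominates; this links
the radius in the theorem to neighbourhood filters. -/
theorem kktDist_lt_imp {n me mi : ℕ} {p pstar : PrimalDual n me mi}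
    {v vstar : EuclideanSpace ℝ (Fin mi)} {r : ℝ} (h : kktDist p pstar v vstar < r) :
    dist (p, v) (pstar, vstar) < r := by
  refine lt_of_le_of_lt ?_ h
  rw [Prod.dist_eq, dist_eq_norm, dist_eq_norm]
  exact max_le (Real.le_sqrt_of_sq_le (by nlinarith [sq_nonneg ‖v - vstar‖]))
    (Real.le_sqrt_of_sq_le (by nlinarith [sq_nonneg ‖p - pstar‖]))

theorem continuous_dualityMeasure {mi : ℕ} : Continuous fun q :
    EuclideanSpace ℝ (Fin mi) × EuclideanSpace ℝ (Fin mi) => dualityMeasure q.1 q.2 := by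
  unfold dualityMeasure
  fun_prop

theorem mul_le_card_mul_dualityMeasure {mi : ℕ} {s v : EuclideanSpace ℝ (Fin mi)}
    (hs : ∀ i, 0 < s i) (hv : ∀ i, 0 < v i) (i : Fin mi) :
    s i * v i ≤ mi * dualityMeasure s v := by
  have hmi : (mi : ℝ) ≠ 0 := by exact_mod_cast i.pos.ne'
  rw [dualityMeasure, mul_div_cancel₀ _ hmi]
  exact Finset.single_le_sum (f := fun i => s i * v i) (fun j _ => (mul_pos (hs j) (hv j)).le)
    (Finset.mem_univ i)

theorem dualityMeasure_pos {mi : ℕ} (hmi : 0 < mi) {s v : EuclideanSpace ℝ (Fin mi)}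
    (hs : ∀ i, 0 < s i) (hv : ∀ i, 0 < v i) : 0 < dualityMeasure s v := by
  have : Nonempty (Fin mi) := ⟨⟨0, hmi⟩⟩
  exact div_pos (Finset.sum_pos (fun i _ => mul_pos (hs i) (hv i)) Finset.univ_nonempty)
    (by exact_mod_cast hmi)

/-! ### The splitting of $K_\gamma$ and its uniform bounds. -/

namespace Matrix

theorem dotProduct_transpose_mul_diagonal_mul_mulVec {ι : Type*} [Fintype ι] [DecidableEq ι]
    {n : ℕ} (A : Matrix ι (Fin n) ℝ) (d : ι → ℝ) (x : Fin n → ℝ) :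
    x ⬝ᵥ (Aᵀ * diagonal d * A) *ᵥ x = ∑ i, d i * (A *ᵥ x) i ^ 2 := by
  rw [Matrix.mul_assoc, ← mulVec_mulVec, ← mulVec_mulVec, dotProduct_mulVec x, vecMul_transpose]
  simp only [dotProduct, mulVec_diagonal]
  exact Finset.sum_congr rfl fun k _ => by ring

theorem transpose_mul_diagonal_mul_eq_add {m n : ℕ} (H : Matrix (Fin m) (Fin n) ℝ)
    (d : Fin m → ℝ) (B : Finset (Fin m)) :
    Hᵀ * diagonal d * H =
      (H.submatrix (fun i : {i // i ∈ B} => (i : Fin m)) id)ᵀ *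
          diagonal (fun i : {i // i ∈ B} => d i) *
          H.submatrix (fun i : {i // i ∈ B} => (i : Fin m)) id
        + Hᵀ * diagonal (fun i => if i ∈ B then 0 else d i) * H := by
  ext a b
  rw [add_apply, mul_apply, mul_apply, mul_apply]
  simp only [mul_diagonal, transpose_apply, submatrix_apply, id]
  rw [Finset.sum_coe_sort B fun i => H i a * d i * H i b, ← Finset.sum_filter_add_sum_filter_not
    Finset.univ (· ∈ B)]
  congr 1
  · simp
  · rw [Finset.sum_filter]
    exact Finset.sum_congr rfl fun i _ => by by_cases hi : i ∈ B <;> simp [hi]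

theorem quadraticForm_ge_of_norm_sub_le {n : ℕ} {M N : Matrix (Fin n) (Fin n) ℝ} {κ ε : ℝ}
    (hM : ∀ x, κ * (x ⬝ᵥ x) ≤ x ⬝ᵥ M *ᵥ x) (h : ‖N - M‖ ≤ ε) (x : Fin n → ℝ) :
    (κ - ε) * (x ⬝ᵥ x) ≤ x ⬝ᵥ N *ᵥ x := by
  have h1 := neg_abs_le (x ⬝ᵥ (N - M) *ᵥ x)
  have h0 : 0 ≤ x ⬝ᵥ x := by rw [← norm_toLp_sq]; positivity
  have h2 : |x ⬝ᵥ (N - M) *ᵥ x| ≤ ε * (x ⬝ᵥ x) :=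
    (abs_dotProduct_mulVec_le _ x).trans (by gcongr)
  have h3 : x ⬝ᵥ (N - M) *ᵥ x = x ⬝ᵥ N *ᵥ x - x ⬝ᵥ M *ᵥ x := by
    rw [sub_mulVec, dotProduct_sub]
  linarith [hM x]

end Matrix

namespace NLP

variable {n me mi : ℕ} {P : NLP n me mi}

/-- The weights of the rows of the active Jacobian in `Kγ`. -/
noncomputable def activeWeights (me : ℕ) (B : Finset (Fin mi)) (γ : ℝ)
    (s v : EuclideanSpace ℝ (Fin mi)) : {i // i ∈ B} ⊕ Fin me → ℝ :=
  Sum.elim (fun i => v i / s i) fun _ => γ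

/-- The part of `Kγ` that does not come from the active constraints. -/
noncomputable def inactivePart (P : NLP n me mi) (B : Finset (Fin mi)) (p : PrimalDual n me mi)
    (v : EuclideanSpace ℝ (Fin mi)) : Matrix (Fin n) (Fin n) ℝ :=
  P.W p v + (P.H p)ᵀ * diagonal (fun i => if i ∈ B then 0 else v i / p.s i) * P.H p

theorem Kγ_eq (B : Finset (Fin mi)) (γ : ℝ) (p : PrimalDual n me mi)
    (v : EuclideanSpace ℝ (Fin mi)) :
    P.Kγ γ p v = (P.activeJacobian B p)ᵀ * diagonal (activeWeights me B γ p.s v) *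
      P.activeJacobian B p + P.inactivePart B p v := by
  have h : (P.activeJacobian B p)ᵀ * diagonal (activeWeights me B γ p.s v) * P.activeJacobian B p
      = ((P.H p).submatrix (fun i : {i // i ∈ B} => (i : Fin mi)) id)ᵀ *
          diagonal (fun i : {i // i ∈ B} => v i / p.s i) *
          (P.H p).submatrix (fun i : {i // i ∈ B} => (i : Fin mi)) id
        + γ • ((P.G p)ᵀ * P.G p) := by
    rw [activeJacobian, activeWeights, ← fromBlocks_diagonal, transpose_fromRows,
      fromCols_mul_fromBlocks, fromCols_mul_fromRows]
    simp only [Matrix.mul_zero, add_zero, zero_add]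
    rw [← smul_one_eq_diagonal]
    simp
  rw [h, Kγ, inactivePart, transpose_mul_diagonal_mul_eq_add (P.H p) _ B]
  abel

theorem card_active_index (x : EuclideanSpace ℝ (Fin n)) :
    Fintype.card ({i // i ∈ P.activeSet x} ⊕ Fin me) = P.numActive x := by
  simp [numActive, add_comm]

theorem mem_activeSet {x : EuclideanSpace ℝ (Fin n)} {i : Fin mi} :
    i ∈ P.activeSet x ↔ P.h x i = 0 := by
  simp [activeSet]

theorem IsKKT.slack_eq {p : PrimalDual n me mi} {v : EuclideanSpace ℝ (Fin mi)}
    (h : P.IsKKT p v) (i : Fin mi) : p.s i = -P.h p.x i := by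
  have h1 : (P.h p.x + p.s) i = 0 := by rw [h.ineq_feasible]; rfl
  rw [PiLp.add_apply] at h1
  linarith

theorem IsKKT.dualityMeasure_eq_zero {p : PrimalDual n me mi} {v : EuclideanSpace ℝ (Fin mi)}
    (h : P.IsKKT p v) : dualityMeasure p.s v = 0 := by
  simp [dualityMeasure, h.complementary]

theorem eventually_dualityMeasure_lt {p : PrimalDual n me mi} {v : EuclideanSpace ℝ (Fin mi)}
    (h : P.IsKKT p v) {τ : ℝ} (hτ : 0 < τ) :
    ∀ᶠ q : PrimalDual n me mi × EuclideanSpace ℝ (Fin mi) in 𝓝 (p, v),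
      dualityMeasure q.1.s q.2 < τ := by
  have hc : Continuous fun q : PrimalDual n me mi × EuclideanSpace ℝ (Fin mi) =>
      dualityMeasure q.1.s q.2 := continuous_dualityMeasure.comp
    ((PrimalDual.continuous_s.comp continuous_fst).prodMk continuous_snd)
  exact hc.continuousAt.eventually_lt continuousAt_const (by simpa [h.dualityMeasure_eq_zero])

/-- Near a regular KKT point the multipliers of the active constraints are bounded away from
zero. -/
theorem exists_active_multiplier_bound {p : PrimalDual n me mi} {v : EuclideanSpace ℝ (Fin mi)}
    (hk : P.IsKKT p v) (hr : P.IsRegular p v) : ∃ μ : ℝ, 0 < μ ∧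
      ∀ᶠ u : EuclideanSpace ℝ (Fin mi) in 𝓝 v, ∀ i ∈ P.activeSet p.x, μ < u i := by
  have hv : ∀ i ∈ P.activeSet p.x, 0 < v i := fun i hi => by
    rw [← sub_eq_zero.1 hk.dual]; exact hr.strict_compl i hi
  have h1 : ∃ μ : ℝ, 0 < μ ∧ ∀ i ∈ P.activeSet p.x, μ < v i := by
    have h2 : ∀ᶠ μ : ℝ in 𝓝[>] 0, ∀ i ∈ P.activeSet p.x, μ < v i :=
      (eventually_all_finset _).2 fun i hi =>
        nhdsWithin_le_nhds (eventually_lt_nhds (hv i hi))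
    obtain ⟨μ, h3, h4⟩ := (h2.and self_mem_nhdsWithin).exists
    exact ⟨μ, h4, h3⟩
  obtain ⟨μ, hμ, h2⟩ := h1
  refine ⟨μ, hμ, (eventually_all_finset _).2 fun i hi => ?_⟩
  exact (PiLp.continuous_apply 2 _ i).continuousAt.eventually (lt_mem_nhds (h2 i hi))

/-- At the solution an inactive constraint has $s_i^\star>0=v_i^\star$. Nearby this keeps $v_i/s_i$
below $1$, so the inactive part stays bounded. -/
theorem eventually_inactive_le {p : PrimalDual n me mi} {v : EuclideanSpace ℝ (Fin mi)}
    (hk : P.IsKKT p v) :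
    ∀ᶠ q : PrimalDual n me mi × EuclideanSpace ℝ (Fin mi) in 𝓝 (p, v),
      ∀ i, i ∉ P.activeSet p.x → q.2 i < q.1.s i := by
  refine eventually_all.2 fun i => ?_
  by_cases hi : i ∈ P.activeSet p.x
  · exact .of_forall fun _ h => absurd hi h
  have hs0 : p.s i ≠ 0 := by rw [hk.slack_eq]; exact neg_ne_zero.2 (mt mem_activeSet.2 hi)
  have hs : 0 < p.s i := (hk.slack_nonneg i).lt_of_ne' hs0
  have hv : v i = 0 := (mul_eq_zero.1 (hk.complementary i)).resolve_left hs0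
  have h1 : Continuous fun q : PrimalDual n me mi × EuclideanSpace ℝ (Fin mi) => q.2 i :=
    (PiLp.continuous_apply 2 _ i).comp continuous_snd
  have h2 : Continuous fun q : PrimalDual n me mi × EuclideanSpace ℝ (Fin mi) => q.1.s i :=
    (PiLp.continuous_apply 2 _ i).comp (PrimalDual.continuous_s.comp continuous_fst)
  filter_upwards [h1.continuousAt.eventually_lt h2.continuousAt (by simpa [hv] using hs)]
    with q hq _ using hq

/-- Uniform bounds on the splitting `Kγ = Aᵀ D A + E` near a regular KKT point. -/
theorem exists_uniform_bounds (hmi : 0 < mi)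
    (hf : ContDiff ℝ 2 P.f) (hg : ContDiff ℝ 2 P.g) (hh : ContDiff ℝ 2 P.h)
    {pstar : PrimalDual n me mi} {vstar : EuclideanSpace ℝ (Fin mi)}
    (hkkt : P.IsKKT pstar vstar) (hreg : P.IsRegular pstar vstar)
    {c₁ : ℝ} (hc₁ : 0 < c₁) :
    ∃ w β κ c η : ℝ, 0 < w ∧ 0 < β ∧ 0 < κ ∧ 0 < c ∧ 0 < η ∧
      ∀ᶠ q : PrimalDual n me mi × EuclideanSpace ℝ (Fin mi) in 𝓝 (pstar, vstar),
        (∀ i, 0 < q.1.s i) → (∀ i, 0 < q.2 i) → ∀ γ : ℝ,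
          c₁ * (dualityMeasure q.1.s q.2)⁻¹ ≤ γ →
          0 < dualityMeasure q.1.s q.2 ∧
          IsUnit (P.activeJacobian (P.activeSet pstar.x) q.1 *
            (P.activeJacobian (P.activeSet pstar.x) q.1)ᵀ).det ∧
          ‖rowPinv (P.activeJacobian (P.activeSet pstar.x) q.1)‖ ≤ β ∧
          ‖P.inactivePart (P.activeSet pstar.x) q.1 q.2‖ ≤ w ∧
          ‖P.activeJacobian (P.activeSet pstar.x) q.1‖ ≤ η ∧
          (∀ i, 0 < activeWeights me (P.activeSet pstar.x) γ q.1.s q.2 i) ∧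
          (∀ i, (activeWeights me (P.activeSet pstar.x) γ q.1.s q.2 i)⁻¹
            ≤ c * dualityMeasure q.1.s q.2) ∧
          2 * w * (c * dualityMeasure q.1.s q.2 * β ^ 2) ≤ 1 / 2 ∧
          (P.Kγ γ q.1 q.2)ᵀ = P.Kγ γ q.1 q.2 ∧
          ∀ x, κ * (x ⬝ᵥ x) ≤ x ⬝ᵥ P.Kγ γ q.1 q.2 *ᵥ x := by
  set B := P.activeSet pstar.x with hB
  obtain ⟨ρ, κ, hρ, hκ, hpen⟩ := exists_penalty_pos (P.W pstar vstar) (P.activeJacobian B pstar)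
    hreg.sosc
  obtain ⟨μ, hμ, hμe⟩ := exists_active_multiplier_bound hkkt hreg
  have hAc := continuous_activeJacobian (P := P) hg hh B
  have hWc := hreg.continuousAt_W
  have hHc : Continuous P.H := (continuous_jacobian hh).comp PrimalDual.continuous_x
  -- The inner factor $1$ bounds the inactive ratios $v_i/s_i$; each $+1$ leaves room for
  -- continuity.
  set w : ℝ := (‖P.W pstar vstar‖ + 1) + (‖P.H pstar‖ + 1) * (1 * (‖P.H pstar‖ + 1)) with hw
  set β : ℝ := ‖rowPinv (P.activeJacobian B pstar)‖ + 1
  -- The two summands bound $\Xi^{-1}D^{-1}$ on active inequalities, by $s_i/v_i=s_iv_i/v_i^2\le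
  -- m_i\Xi/\mu^2$, and on equalities, by $\gamma^{-1}\le\Xi/c_1$.
  set c : ℝ := mi / μ ^ 2 + c₁⁻¹
  have hw0 : 0 < w := by positivity
  have hβ0 : 0 < β := by positivity
  have hc0 : 0 < c := by positivity
  -- With fixed penalty $\rho$ the matrix $W+\rho A^\top A$ is continuous at the solution, so half
  -- the margin survives nearby. The unbounded weights play no role here.
  have hquad : ∀ᶠ p in 𝓝 pstar, ∀ x, κ / 2 * (x ⬝ᵥ x) ≤
      x ⬝ᵥ P.W p vstar *ᵥ x +
        ρ * (P.activeJacobian B p *ᵥ x ⬝ᵥ P.activeJacobian B p *ᵥ x) := by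
    have hN : ContinuousAt (fun p => P.W p vstar +
        ρ • ((P.activeJacobian B p)ᵀ * P.activeJacobian B p)) pstar :=
      hWc.add ((hAc.matrix_transpose.matrix_mul hAc).const_smul ρ).continuousAt
    have hform : ∀ p x, x ⬝ᵥ (P.W p vstar +
        ρ • ((P.activeJacobian B p)ᵀ * P.activeJacobian B p)) *ᵥ x = x ⬝ᵥ P.W p vstar *ᵥ x +
        ρ * (P.activeJacobian B p *ᵥ x ⬝ᵥ P.activeJacobian B p *ᵥ x) := fun p x => by
      rw [add_mulVec, dotProduct_add, smul_mulVec, dotProduct_smul, smul_eq_mul,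
        mulVec_dotProduct_mulVec]
    filter_upwards [Metric.continuousAt_iff'.1 hN (κ / 2) (by positivity)] with p hp x
    rw [dist_eq_norm] at hp
    have := quadraticForm_ge_of_norm_sub_le (κ := κ) (fun x => by rw [hform]; exact hpen x) hp.le x
    rw [hform] at this
    linarith
  refine ⟨w, β, κ / 2, c, ‖P.activeJacobian B pstar‖ + 1, hw0, hβ0, by positivity, hc0,
    by positivity, ?_⟩
  have hp := (eventually_rowPinv_le hAc (isUnit_det_mul_transpose hreg.licq)).and
    ((hAc.norm.continuousAt.eventually_lt_const (lt_add_one _)).and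
    ((hWc.norm.eventually_lt_const (lt_add_one _)).and
    ((hHc.norm.continuousAt.eventually_lt_const (lt_add_one _)).and hquad)))
  filter_upwards [(continuousAt_fst (p := (pstar, vstar))).eventually hp,
    (continuousAt_snd (p := (pstar, vstar))).eventually hμe, eventually_inactive_le hkkt,
    -- The first threshold gives the smallness condition of the perturbation bounds. The second
    -- gives $D^{-1}\le(\rho+1)^{-1}$, hence weights above $\rho$; using $\rho+1$ covers $\rho=0$.
    eventually_dualityMeasure_lt hkkt (τ := (4 * w * c * β ^ 2)⁻¹) (by positivity),
    eventually_dualityMeasure_lt hkkt (τ := (c * (ρ + 1))⁻¹) (by positivity)]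
    with q ⟨⟨hdet, hβ⟩, hA, hW, hH, hq⟩ hμq hin hΞ₁ hΞ₂ hs hv γ hγ
  have hΞ := dualityMeasure_pos hmi hs hv
  set Ξ := dualityMeasure q.1.s q.2
  rw [W_congr_multiplier _ _ q.2] at hW
  simp only [W_congr_multiplier _ vstar q.2] at hq
  have hγ0 : 0 < γ := lt_of_lt_of_le (by positivity) hγ
  have hD : ∀ i, 0 < activeWeights me B γ q.1.s q.2 i := by
    rintro (i | i)
    · exact div_pos (hv i) (hs i)
    · exact hγ0
  have hδ : ∀ i, (activeWeights me B γ q.1.s q.2 i)⁻¹ ≤ c * Ξ := by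
    rintro (i | i)
    · simp only [activeWeights, Sum.elim_inl, inv_div]
      have h1 := mul_le_card_mul_dualityMeasure hs hv i
      have h2 : q.1.s i / q.2 i ≤ mi / μ ^ 2 * Ξ := by
        rw [div_mul_eq_mul_div, div_le_div_iff₀ (hv i) (by positivity)]
        have h3 : μ ^ 2 ≤ q.2 i ^ 2 := pow_le_pow_left₀ hμ.le (hμq i i.2).le 2
        calc q.1.s i * μ ^ 2 ≤ q.1.s i * q.2 i ^ 2 := by
              have := (hs i).le; gcongr
          _ = q.1.s i * q.2 i * q.2 i := by ring
          _ ≤ mi * Ξ * q.2 i := mul_le_mul_of_nonneg_right h1 (hv i).le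
      have h4 : 0 ≤ c₁⁻¹ * Ξ := by positivity
      linarith [add_mul ((mi : ℝ) / μ ^ 2) c₁⁻¹ Ξ]
    · simp only [activeWeights, Sum.elim_inr]
      have h1 : γ⁻¹ ≤ c₁⁻¹ * Ξ := by
        have := inv_anti₀ (by positivity) hγ
        rwa [mul_inv, inv_inv] at this
      have h4 : 0 ≤ mi / μ ^ 2 * Ξ := by positivity
      linarith [add_mul ((mi : ℝ) / μ ^ 2) c₁⁻¹ Ξ]
  have hDρ : ∀ i, ρ ≤ activeWeights me B γ q.1.s q.2 i := fun i => by
    have h1 : (activeWeights me B γ q.1.s q.2 i)⁻¹ ≤ (ρ + 1)⁻¹ := by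
      refine (hδ i).trans ?_
      rw [mul_inv] at hΞ₂
      have := mul_le_mul_of_nonneg_left hΞ₂.le hc0.le
      rwa [← mul_assoc, mul_inv_cancel₀ hc0.ne', one_mul] at this
    linarith [(inv_le_inv₀ (hD i) (by positivity)).1 h1]
  refine ⟨hΞ, hdet, hβ, ?_, hA.le, hD, hδ, ?_, ?_, fun x => ?_⟩
  · refine (norm_add_le _ _).trans (add_le_add hW.le ?_)
    rw [Matrix.mul_assoc]
    refine l2_opNorm_mul_le_of_le ((l2_opNorm_transpose _).trans_le hH.le)
      (l2_opNorm_mul_le_of_le ?_ hH.le)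
    rw [l2_opNorm_diagonal]
    refine (pi_norm_le_iff_of_nonneg zero_le_one).2 fun i => ?_
    by_cases hi : i ∈ B
    · simp [hi]
    · rw [if_neg hi, Real.norm_of_nonneg (div_pos (hv i) (hs i)).le, div_le_one (hs i)]
      exact (hin i hi).le
  · have h1 : Ξ * (4 * w * c * β ^ 2) ≤ 1 := by
      have := mul_le_mul_of_nonneg_right hΞ₁.le (show 0 ≤ 4 * w * c * β ^ 2 by positivity)
      rwa [inv_mul_cancel₀ (by positivity)] at this
    linarith
  · rw [Kγ]
    simp only [transpose_add, transpose_mul, transpose_smul, transpose_transpose,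
      diagonal_transpose, W_transpose hf hg hh, Matrix.mul_assoc]
  · rw [Kγ_eq B, inactivePart, add_mulVec, add_mulVec, dotProduct_add, dotProduct_add,
      dotProduct_transpose_mul_diagonal_mul_mulVec, dotProduct_transpose_mul_diagonal_mul_mulVec]
    have h1 : ρ * (P.activeJacobian B q.1 *ᵥ x ⬝ᵥ P.activeJacobian B q.1 *ᵥ x) ≤
        ∑ i, activeWeights me B γ q.1.s q.2 i * (P.activeJacobian B q.1 *ᵥ x) i ^ 2 := by
      rw [dotProduct, Finset.mul_sum]
      refine Finset.sum_le_sum fun i _ => ?_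
      rw [← pow_two]
      exact mul_le_mul_of_nonneg_right (hDρ i) (sq_nonneg _)
    -- Inactive inequalities only add to the quadratic form, so the penalized bound carries over to
    -- $K_\gamma$.
    have h2 : 0 ≤ ∑ i, (if i ∈ B then 0 else q.2 i / q.1.s i) * (P.H q.1 *ᵥ x) i ^ 2 := by
      refine Finset.sum_nonneg fun i _ => mul_nonneg ?_ (sq_nonneg _)
      split_ifs
      · exact le_rfl
      · exact (div_pos (hv i) (hs i)).le
    linarith [hq x]

end NLP

/-! ### The main theorem. -/

theorem mainTheorem3 {n me mi : ℕ} (hmi : 0 < mi) (P : NLP n me mi)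
    (hf : ContDiff ℝ 2 P.f) (hg : ContDiff ℝ 2 P.g) (hh : ContDiff ℝ 2 P.h)
    (pstar : PrimalDual n me mi) (vstar : EuclideanSpace ℝ (Fin mi))
    (hkkt : P.IsKKT pstar vstar) (hreg : P.IsRegular pstar vstar)
    (C α c₁ c₂ : ℝ) (hC : 0 < C) (hα : 0 < α) (hα1 : α < 1) (hc₁ : 0 < c₁) (hc₁₂ : c₁ ≤ c₂) :
    ∃ r : ℝ, 0 < r ∧
      (∃ b : ℝ, 0 < b ∧
        ∀ (p : PrimalDual n me mi) (v : EuclideanSpace ℝ (Fin mi)) (γ : ℝ),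
          kktDist p pstar v vstar < r → P.IsCentral C α p v →
          c₁ * (dualityMeasure p.s v)⁻¹ ≤ γ → γ ≤ c₂ * (dualityMeasure p.s v)⁻¹ →
          (P.Kγ γ p v).PosDef ∧
          ∀ (UL : Matrix (Fin n) (Fin (P.numActive pstar.x)) ℝ)
            (US : Matrix (Fin n) (Fin (n - P.numActive pstar.x)) ℝ)
            (σL : Fin (P.numActive pstar.x) → ℝ) (σS : Fin (n - P.numActive pstar.x) → ℝ),
            IsSpectralSplit (P.Kγ γ p v) UL US σL σS →
            ∃ (Y : Matrix (Fin n) (Fin (P.numActive pstar.x)) ℝ)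
              (Z : Matrix (Fin n) (Fin (n - P.numActive pstar.x)) ℝ),
              IsOrthonormalBasisMatrix Y (LinearMap.range
                (P.activeJacobian (P.activeSet pstar.x) p).transpose.mulVecLin) ∧
              IsOrthonormalBasisMatrix Z (LinearMap.ker
                (P.activeJacobian (P.activeSet pstar.x) p).mulVecLin) ∧
              ‖UL - Y‖ ≤ b * dualityMeasure p.s v ∧ ‖US - Z‖ ≤ b * dualityMeasure p.s v) ∧
      (∀ b : ℝ, 0 < b → ∃ M : ℝ, 0 < M ∧
        ∀ (p : PrimalDual n me mi) (v : EuclideanSpace ℝ (Fin mi)) (γ : ℝ),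
          kktDist p pstar v vstar < r → P.IsCentral C α p v →
          c₁ * (dualityMeasure p.s v)⁻¹ ≤ γ → γ ≤ c₂ * (dualityMeasure p.s v)⁻¹ →
          ∀ (UL : Matrix (Fin n) (Fin (P.numActive pstar.x)) ℝ)
            (US : Matrix (Fin n) (Fin (n - P.numActive pstar.x)) ℝ)
            (σL : Fin (P.numActive pstar.x) → ℝ) (σS : Fin (n - P.numActive pstar.x) → ℝ),
            IsSpectralSplit (P.Kγ γ p v) UL US σL σS →
            ∀ Y : Matrix (Fin n) (Fin (P.numActive pstar.x)) ℝ,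
              IsOrthonormalBasisMatrix Y (LinearMap.range
                (P.activeJacobian (P.activeSet pstar.x) p).transpose.mulVecLin) →
              ‖UL - Y‖ ≤ b * dualityMeasure p.s v →
              ‖P.Sγ γ p v - P.G p * Y * (Matrix.diagonal σL)⁻¹ * Y.transpose
                * (P.G p).transpose‖ ≤ M * dualityMeasure p.s v ^ 2) := by
  obtain ⟨w, β, κ, c, η, hw, hβ0, hκ, hc, hη, hev⟩ :=
    NLP.exists_uniform_bounds hmi hf hg hh hkkt hreg hc₁
  obtain ⟨r, hr, hball⟩ := Metric.eventually_nhds_iff.1 hev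
  have hcard := P.card_active_index pstar.x
  -- Both constants come from the perturbation bounds with $\delta=c\,\Xi$ and $\varepsilon=b\,\Xi$.
  -- The radius is independent of $b$, which enters only the constant of the second part.
  refine ⟨r, hr, ⟨4 * w * β ^ 2 * c, by positivity, fun p v γ hd hcen hγ₁ _ => ?_⟩,
    fun b hb => ⟨4 * η ^ 2 * β ^ 2 * (b * c) + 4 * w ^ 2 * β ^ 2 * κ⁻¹ * c ^ 2, by positivity,
      fun p v γ hd hcen hγ₁ _ UL US σL σS hsplit Y hY hYn => ?_⟩⟩
  · obtain ⟨hΞ, hdet, hβ, hE, -, hD, hδ, hsmall, hsymm, hquad⟩ :=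
      hball (kktDist_lt_imp hd) hcen.slack_pos hcen.mult_pos γ hγ₁
    have hpos : ∀ x : Fin n → ℝ, x ≠ 0 → 0 < dotProduct x ((P.Kγ γ p v).mulVec x) :=
      fun x hx => by
        refine lt_of_lt_of_le ?_ (hquad x)
        rw [← norm_toLp_sq]
        have : WithLp.toLp 2 x ≠ 0 := by simpa using hx
        positivity
    refine ⟨PosDef.of_dotProduct_mulVec_pos
      (by rwa [IsHermitian, conjTranspose_eq_transpose_of_trivial])
      (fun x hx => by simpa using hpos x hx), fun UL US σL σS hsplit => ?_⟩
    obtain ⟨Y, Z, hY, hZ, hYn, hZn⟩ := hsplit.exists_bases_near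
      (fun x => le_trans (by rw [← norm_toLp_sq]; positivity) (hquad x)) hcard hdet hβ hβ0
      (NLP.Kγ_eq _ γ p v) hE hD hδ (by positivity) hsmall
    exact ⟨Y, Z, hY, hZ, by linarith, by linarith⟩
  · obtain ⟨hΞ, hdet, hβ, hE, hA, hD, hδ, hsmall, -, hquad⟩ :=
      hball (kktDist_lt_imp hd) hcen.slack_pos hcen.mult_pos γ hγ₁
    have hGA : ‖P.G p * US‖ ≤ ‖P.activeJacobian (P.activeSet pstar.x) p * US‖ := by
      rw [NLP.activeJacobian, fromRows_mul]
      exact l2_opNorm_le_fromRows_right _ _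
    refine (hsplit.norm_schur_sub_le hκ hquad hcard hdet hβ hβ0 (NLP.Kγ_eq _ γ p v) hE hD hδ
      (by positivity) (by linarith) ((l2_opNorm_le_fromRows_right _ _).trans hA) hGA hY.1
      hYn).trans (le_of_eq ?_)
    ring
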